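/- Let $K\in C^1(\mathbb R^2)$ and let $A\subset\mathbb R^2$ be an open set with compact closure. Assume that $K$ has a stable critical point in $A$, that is, there is $r>0$ such that every $G\in C^1(\overline A)$ with $\|G-K\|_{C^1(\overline A)}<r$ has a critical point in $A$. For a function $H:\mathbb R^2\to\mathbb R$, an embedded $H$-loop is an injective map $u\in C^2(\mathbb S^1,\mathbb R^2)$ whose derivative (with respect to the angle) never vanishes and whose curvature satisfies $\langle u'',iu'\rangle/|u'|^3=H(u)$ at each point, where $i$ is the rotation by $\pi/2$. Then there exists $k_0>1$ such that for every $k>k_0$ there are $\varepsilon_0(k)>0$ and, for every $\varepsilon\in\mathbb R$ with $|\varepsilon|<\varepsilon_0(k)$, an embedded $(k+\varepsilon K)$-loop $u^{k,\varepsilon}:\mathbb S^1\to\mathbb R^2$. Moreover, $\varepsilon_0$ and the loops $u^{k,\varepsilon}$ can be chosen such that for all sequences $k_h\to\infty$, $\varepsilon_h\to0$ with $k_h>k_0$ and $|\varepsilon_h|<\varepsilon_0(k_h)$ there are a subsequence $h_j$ and a critical point $z_0\in\overline A$ of $K$ such that $u^{k_{h_j},\varepsilon_{h_j}}$ converges in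 $C^2(\mathbb S^1,\mathbb R^2)$ to the constant curve $z_0$ as $j\to\infty$. -/

import Mathlib

open Filter Topology

/-! The plane `ℝ²` is identified with `ℂ`, regarded as a real inner product space; the rotation
`i` of `ℝ²` is multiplication by `Complex.I`. -/

/-- The `2π`-periodic function of the angle associated with a curve `u : 𝕊¹ → ℝ²`.
Its derivative at `t` is `u'(x)(i x)` with `x = e^{it}`, which is the derivative of `u` at `x`. -/
noncomputable def angleLift (u : Circle → ℂ) (t : ℝ) : ℂ := u (Circle.exp t)

/-- The curvature `⟨u'', i u'⟩ / |u'|³` of a plane curve at the point of angle `t`. -/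
noncomputable def curveCurvature (u : Circle → ℂ) (t : ℝ) : ℝ :=
  inner ℝ (deriv (deriv (angleLift u)) t) (Complex.I * deriv (angleLift u) t) /
    ‖deriv (angleLift u) t‖ ^ 3

/-- A loop: a curve `𝕊¹ → ℝ²` of class `C²` with nonzero derivative at each point. -/
structure IsLoop (u : Circle → ℂ) : Prop where
  contDiff : ContDiff ℝ 2 (angleLift u)
  regular : ∀ t : ℝ, deriv (angleLift u) t ≠ 0

/-- An embedded `H`-loop: an injective loop whose curvature at each of its points `u x` is
`H (u x)`. -/
structure IsEmbeddedLoop (H : ℂ → ℝ) (u : Circle → ℂ) : Prop where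
  isLoop : IsLoop u
  injective : Function.Injective u
  curvature_eq : ∀ t : ℝ, curveCurvature u t = H (u (Circle.exp t))

/-- Convergence in `C²(𝕊¹, ℝ²)`: uniform convergence of the curves and of their first two
derivatives. -/
def TendstoC2 (v : ℕ → Circle → ℂ) (w : Circle → ℂ) : Prop :=
  ∀ m : ℕ, m ≤ 2 →
    TendstoUniformly (fun j => iteratedDeriv m (angleLift (v j)))
      (iteratedDeriv m (angleLift w)) atTop

/-- `G ∈ C¹(closure A)` with differential `D`: `G` is differentiable in the open set `A`, and
`G` and its differential extend continuously to `closure A` (the extensions being the values of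
`G` and `D` there). -/
structure IsC1Closure (A : Set ℂ) (G : ℂ → ℝ) (D : ℂ → ℂ →L[ℝ] ℝ) : Prop where
  continuousOn : ContinuousOn G (closure A)
  continuousOn_deriv : ContinuousOn D (closure A)
  hasFDerivAt : ∀ z ∈ A, HasFDerivAt G (D z) z

/-- `X ∈ C¹(ℝ²)` has a stable critical point in `A` (an open set with compact closure): for some
`r > 0`, every `G ∈ C¹(closure A)` at `C¹(closure A)`-distance less than `r` from `X` has a
critical point in `A`. -/
def HasStableCriticalPoint (X : ℂ → ℝ) (A : Set ℂ) : Prop :=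
  ∃ r : ℝ, 0 < r ∧ ∀ (G : ℂ → ℝ) (D : ℂ → ℂ →L[ℝ] ℝ), IsC1Closure A G D →
    (∀ z ∈ closure A, |G z - X z| < r ∧ ‖D z - fderiv ℝ X z‖ < r) →
    ∃ z ∈ A, D z = 0

/-! The proof is a Lyapunov–Schmidt reduction in the tangent angle. If `H = k + ε K` is positive
along a closed curve with `H(U) U' = i e^{it}`, the curve has curvature `H`, and its tangent turns
exactly once, so it is embedded (`isEmbeddedLoop_of_ode`). For large `k` such curves are almost
circles of radius `1/k`, and the only real unknown is the centre.

For each mean value `z`, a contraction on derivatives (`exists_fixed_velocity`) solves the equation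
up to a constant vector, equal to `ε` times the mean of `K(U) U'`. It remains to choose `z` so that
this vector vanishes. The equation is variational: if `∂X/∂x = H`, the form `X dy` has differential
`H dx ∧ dy`, and `∫ X(U) dy - ∫ ⟨e^{it}, U⟩` has first variation `-i H(U) U' - e^{it}`
(`first_variation`). Along the family of approximate solutions this variation is constant in `t`, so
the reduced action is a function of `z` whose gradient is `2π` times the constant vector rotated by
`-i` (`hasFDerivAt_action`).

In the expansion of `K` around `z`, the constant term contributes nothing because the curve is
closed, and the linear term on the circle gives the gradient of `K`. Hence the reduced action times
`k²/(πε)` is, up to an additive constant, `C¹`-close to `K`, uniformly in small `ε`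
(`exists_reducedGradient_close`), and stability yields a critical point in `A`. When `ε = 0` every
centre works, and a critical point of `K` is selected.

As `k → ∞` the first two derivatives are `O(1/k)`, and the centres subconverge in the compact
closure of `A`. The same gradient comparison shows that their limit is critical. -/

/-! ### Primitives in one variable and uniform first-order estimates -/

section Calculus

/-- The linear map `x + i y ↦ s x + i y`. -/
noncomputable def scaleRe (s : ℝ) : ℂ →L[ℝ] ℂ :=
  s • Complex.reCLM.smulRight (1 : ℂ) + Complex.imCLM.smulRight Complex.I

lemma scaleRe_apply (s : ℝ) (z : ℂ) : scaleRe s z = (s * z.re : ℝ) + z.im * Complex.I := by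
  simp [scaleRe]

lemma continuous_scaleRe : Continuous scaleRe := by
  unfold scaleRe; fun_prop

/-- A primitive `x + i y ↦ ∫₀ˣ f(σ + i y) dσ` of `f` with respect to the real part. -/
noncomputable def rePrimitive (f : ℂ → ℝ) (z : ℂ) : ℝ :=
  z.re * ∫ s in (0 : ℝ)..1, f (scaleRe s z)

lemma hasFDerivAt_integral_scaleRe {f : ℂ → ℝ} (hf : ContDiff ℝ 1 f) (z₀ : ℂ) :
    HasFDerivAt (fun z => ∫ s in (0 : ℝ)..1, f (scaleRe s z))
      (∫ s in (0 : ℝ)..1, (fderiv ℝ f (scaleRe s z₀)).comp (scaleRe s)) z₀ := by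
  have hfd : Continuous (fderiv ℝ f) := hf.continuous_fderiv one_ne_zero
  have happ : Continuous (fun p : ℝ × ℂ => scaleRe p.1 p.2) :=
    (continuous_scaleRe.comp continuous_fst).clm_apply continuous_snd
  have hF' : Continuous (fun p : ℝ × ℂ => (fderiv ℝ f (scaleRe p.1 p.2)).comp (scaleRe p.1)) :=
    (hfd.comp happ).clm_comp (continuous_scaleRe.comp continuous_fst)
  obtain ⟨C, hC⟩ := ((isCompact_Icc (a := (0 : ℝ)) (b := 1)).prod
    (isCompact_closedBall z₀ 1)).exists_bound_of_continuousOn hF'.continuousOn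
  have hcs : ∀ z, Continuous (fun s => scaleRe s z) := fun z =>
    happ.comp (Continuous.prodMk_left z)
  refine (intervalIntegral.hasFDerivAt_integral_of_dominated_of_fderiv_le
    (F' := fun z s => (fderiv ℝ f (scaleRe s z)).comp (scaleRe s)) (bound := fun _ => C)
    (Metric.closedBall_mem_nhds z₀ one_pos) ?_ ?_ ?_ ?_ ?_ ?_)
  · exact Eventually.of_forall fun z => (hf.continuous.comp (hcs z)).aestronglyMeasurable
  · exact (hf.continuous.comp (hcs z₀)).intervalIntegrable _ _
  · exact (hF'.comp (Continuous.prodMk_left z₀)).aestronglyMeasurable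
  · refine Eventually.of_forall fun s hs z hz => hC (s, z) ⟨?_, hz⟩
    rw [Set.uIoc_of_le zero_le_one] at hs
    exact ⟨hs.1.le, hs.2⟩
  · exact intervalIntegrable_const
  · refine Eventually.of_forall fun s _ z _ => ?_
    exact ((hf.differentiable one_ne_zero _).hasFDerivAt).comp z (scaleRe s).hasFDerivAt

/-- With the interval of integration rescaled to `[0, 1]`, differentiation under the integral sign
gives regularity in both variables at once. -/
lemma contDiff_rePrimitive {f : ℂ → ℝ} (hf : ContDiff ℝ 1 f) : ContDiff ℝ 1 (rePrimitive f) := by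
  have hfd : Continuous (fderiv ℝ f) := hf.continuous_fderiv one_ne_zero
  have happ : Continuous (fun p : ℂ × ℝ => scaleRe p.2 p.1) :=
    (continuous_scaleRe.comp continuous_snd).clm_apply continuous_fst
  have hF' : Continuous (fun p : ℂ × ℝ => (fderiv ℝ f (scaleRe p.2 p.1)).comp (scaleRe p.2)) :=
    (hfd.comp happ).clm_comp (continuous_scaleRe.comp continuous_snd)
  have hQ : ContDiff ℝ 1 (fun z => ∫ s in (0 : ℝ)..1, f (scaleRe s z)) := by
    rw [contDiff_one_iff_hasFDerivAt]
    exact ⟨_, intervalIntegral.continuous_parametric_intervalIntegral_of_continuous' hF' 0 1,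
      hasFDerivAt_integral_scaleRe hf⟩
  exact (Complex.reCLM.contDiff).mul hQ

lemma fderiv_rePrimitive_one {f : ℂ → ℝ} (hf : ContDiff ℝ 1 f) (z : ℂ) :
    fderiv ℝ (rePrimitive f) z 1 = f z := by
  have hX : HasFDerivAt (rePrimitive f) (fderiv ℝ (rePrimitive f) z) z :=
    ((contDiff_rePrimitive hf).differentiable one_ne_zero z).hasFDerivAt
  have hline : HasDerivAt (fun x : ℝ => (x : ℂ) + z.im * Complex.I) 1 z.re := by
    simpa using (Complex.ofRealCLM.hasDerivAt (x := z.re)).add_const (z.im * Complex.I)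
  have hz : (z.re : ℂ) + z.im * Complex.I = z := Complex.re_add_im z
  have h1 : HasDerivAt (fun x : ℝ => rePrimitive f ((x : ℂ) + z.im * Complex.I))
      (fderiv ℝ (rePrimitive f) z 1) z.re := by
    rw [← hz] at hX
    have := hX.comp_hasDerivAt z.re hline
    rw [hz] at this
    exact this
  have h2 : (fun x : ℝ => rePrimitive f ((x : ℂ) + z.im * Complex.I)) =
      fun x => ∫ s in (0 : ℝ)..x, f ((s : ℂ) + z.im * Complex.I) := by
    ext x
    have := intervalIntegral.smul_integral_comp_mul_right
      (a := 0) (b := 1) (fun s : ℝ => f ((s : ℂ) + z.im * Complex.I)) x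
    simp only [zero_mul, one_mul, smul_eq_mul] at this
    rw [← this]
    simp [rePrimitive, scaleRe_apply]
  rw [h2] at h1
  have hc : Continuous (fun s : ℝ => f ((s : ℂ) + z.im * Complex.I)) :=
    hf.continuous.comp (by fun_prop)
  have h3 := intervalIntegral.integral_hasDerivAt_right (hc.intervalIntegrable 0 z.re)
    hc.aestronglyMeasurable.stronglyMeasurableAtFilter hc.continuousAt
  simpa [hz] using h1.unique h3

/-- Uniform continuity of the differential on a compact ball replaces a bound on second derivatives,
since `K` is only `C¹`. -/
lemma exists_uniform_taylor {f : ℂ → ℝ} (hf : ContDiff ℝ 1 f) (R : ℝ) {η : ℝ} (hη : 0 < η) :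
    ∃ d > 0, ∀ a ∈ Metric.closedBall (0 : ℂ) R, ∀ b ∈ Metric.closedBall (0 : ℂ) R,
      ‖b - a‖ ≤ d → |f b - f a - fderiv ℝ f a (b - a)| ≤ η * ‖b - a‖ := by
  have hfd : Continuous (fderiv ℝ f) := hf.continuous_fderiv one_ne_zero
  have huc := (isCompact_closedBall (0 : ℂ) R).uniformContinuousOn_of_continuous hfd.continuousOn
  obtain ⟨d, hd, h⟩ := Metric.uniformContinuousOn_iff_le.1 huc η hη
  refine ⟨d, hd, fun a ha b hb hab => ?_⟩
  have hconv : Convex ℝ (Metric.closedBall (0 : ℂ) R ∩ Metric.closedBall a d) :=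
    (convex_closedBall _ _).inter (convex_closedBall _ _)
  exact hconv.norm_image_sub_le_of_norm_hasFDerivWithin_le' (f' := fderiv ℝ f)
    (fun x _ => ((hf.differentiable one_ne_zero x).hasFDerivAt).hasFDerivWithinAt)
    (fun x hx => by simpa [dist_eq_norm] using h x hx.1 a ha hx.2)
    ⟨ha, Metric.mem_closedBall_self hd.le⟩ ⟨hb, by simpa [dist_eq_norm] using hab⟩

lemma exists_bound_and_lipschitz {f : ℂ → ℝ} (hf : ContDiff ℝ 1 f) (R : ℝ) :
    ∃ M > 0, (∀ a ∈ Metric.closedBall (0 : ℂ) R, |f a| ≤ M ∧ ‖fderiv ℝ f a‖ ≤ M) ∧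
      ∀ a ∈ Metric.closedBall (0 : ℂ) R, ∀ b ∈ Metric.closedBall (0 : ℂ) R,
        |f b - f a| ≤ M * ‖b - a‖ := by
  have hfd : Continuous (fderiv ℝ f) := hf.continuous_fderiv one_ne_zero
  obtain ⟨C, hC⟩ := (isCompact_closedBall (0 : ℂ) R).exists_bound_of_continuousOn
    hf.continuous.continuousOn
  obtain ⟨C', hC'⟩ := (isCompact_closedBall (0 : ℂ) R).exists_bound_of_continuousOn
    hfd.continuousOn
  have hb : ∀ a ∈ Metric.closedBall (0 : ℂ) R, ‖fderiv ℝ f a‖ ≤ max (max C C') 1 :=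
    fun a ha => (hC' a ha).trans ((le_max_right _ _).trans (le_max_left _ _))
  refine ⟨max (max C C') 1, by positivity, fun a ha =>
    ⟨(hC a ha).trans ((le_max_left _ _).trans (le_max_left _ _)), hb a ha⟩, fun a ha b hb' => ?_⟩
  exact (convex_closedBall (0 : ℂ) R).norm_image_sub_le_of_norm_fderiv_le
    (fun x _ => hf.differentiable one_ne_zero x) hb ha hb'

end Calculus

/-! ### Closed curves parametrized by the tangent angle -/

section Curves

/-- The unit vector of angle `t`. -/
noncomputable def unitVec (t : ℝ) : ℂ := Complex.exp (t * Complex.I)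

lemma unitVec_re (t : ℝ) : (unitVec t).re = Real.cos t := Complex.exp_ofReal_mul_I_re t

lemma unitVec_im (t : ℝ) : (unitVec t).im = Real.sin t := Complex.exp_ofReal_mul_I_im t

lemma norm_unitVec (t : ℝ) : ‖unitVec t‖ = 1 := Complex.norm_exp_ofReal_mul_I t

lemma unitVec_ne_zero (t : ℝ) : unitVec t ≠ 0 := Complex.exp_ne_zero _

lemma contDiff_unitVec {n : WithTop ℕ∞} : ContDiff ℝ n unitVec :=
  (Complex.ofRealCLM.contDiff.mul contDiff_const).cexp

lemma continuous_unitVec : Continuous unitVec := by unfold unitVec; fun_prop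

lemma hasDerivAt_unitVec (t : ℝ) : HasDerivAt unitVec (Complex.I * unitVec t) t := by
  have h := ((Complex.ofRealCLM.hasDerivAt (x := t)).mul_const Complex.I).cexp
  unfold unitVec
  simpa [mul_comm] using h

lemma unitVec_periodic : Function.Periodic unitVec (2 * Real.pi) := fun t => by
  simp [unitVec, add_mul, Complex.exp_add, Complex.exp_two_pi_mul_I]

/-- The closed curve whose expression in the angle is the `2π`-periodic function `U`. -/
noncomputable def circleCurve (U : ℝ → ℂ) (x : Circle) : ℂ := U (Complex.arg x)

lemma angleLift_circleCurve {U : ℝ → ℂ} (hU : Function.Periodic U (2 * Real.pi)) :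
    angleLift (circleCurve U) = U := by
  ext t
  have h := Circle.exp_arg (Circle.exp t)
  obtain ⟨m, hm⟩ := Circle.exp_eq_exp.1 h
  simp only [angleLift, circleCurve, hm]
  exact hU.int_mul m t

lemma inner_unitVec (a b : ℝ) : inner ℝ (unitVec a) (unitVec b) = Real.cos (a - b) := by
  rw [Complex.inner, Real.cos_sub, Complex.mul_re, Complex.conj_re, Complex.conj_im,
    unitVec_re, unitVec_re, unitVec_im, unitVec_im]
  ring

/-- An arc along which the tangent turns by at most `π` is not closed. -/
lemma ne_of_tangent_angle {U : ℝ → ℂ} {g : ℝ → ℝ} (hg : Continuous g) (hpos : ∀ t, 0 < g t)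
    (hU : ∀ t, HasDerivAt U (g t • (Complex.I * unitVec t)) t) {a b : ℝ} (hab : a < b)
    (hba : b - a ≤ Real.pi) : U a ≠ U b := by
  -- The tangent direction at the middle angle: all tangents inside the arc make an angle less than
  -- `π/2` with it, so the component of `U` along `w` increases.
  set w : ℂ := Complex.I * unitVec ((a + b) / 2)
  have hd : ∀ t, HasDerivAt (fun t => inner ℝ w (U t))
      (g t * Real.cos ((a + b) / 2 - t)) t := by
    intro t
    have h := ((innerSL ℝ w).hasFDerivAt (x := U t)).comp_hasDerivAt t (hU t)
    have h2 : inner ℝ w (g t • (Complex.I * unitVec t)) =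
        g t * Real.cos ((a + b) / 2 - t) := by
      rw [inner_smul_right, ← inner_unitVec]
      simp only [w, Complex.inner, Complex.mul_re, Complex.mul_im, Complex.conj_re,
        Complex.conj_im, Complex.I_re, Complex.I_im]
      ring
    rw [← h2]
    exact h
  have hc : Continuous (fun t => g t * Real.cos ((a + b) / 2 - t)) := by fun_prop
  have hint := intervalIntegral.integral_eq_sub_of_hasDerivAt (fun t _ => hd t)
    (hc.intervalIntegrable a b)
  have hp := intervalIntegral.intervalIntegral_pos_of_pos_on (hc.intervalIntegrable a b)
    (fun t ht => mul_pos (hpos t) (Real.cos_pos_of_mem_Ioo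
      ⟨by linarith [ht.1, ht.2], by linarith [ht.1, ht.2]⟩)) hab
  intro h
  rw [hint, h, sub_self] at hp
  exact hp.false

/-- Two distinct points cut the closed curve into two arcs, and the tangent turns by at most `π`
along one of them. -/
lemma circleCurve_injective {U : ℝ → ℂ} {g : ℝ → ℝ} (hg : Continuous g) (hpos : ∀ t, 0 < g t)
    (hU : ∀ t, HasDerivAt U (g t • (Complex.I * unitVec t)) t)
    (hper : Function.Periodic U (2 * Real.pi)) : Function.Injective (circleCurve U) := by
  have key : ∀ a b : ℝ, a < b → b < a + 2 * Real.pi → U a ≠ U b := by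
    intro a b hab hb
    by_cases h : b - a ≤ Real.pi
    · exact ne_of_tangent_angle hg hpos hU hab h
    · have := ne_of_tangent_angle hg hpos hU hb (by linarith)
      rw [hper a] at this
      exact this.symm
  intro x y hxy
  have hx := Complex.neg_pi_lt_arg (x : ℂ)
  have hx' := Complex.arg_le_pi (x : ℂ)
  have hy := Complex.neg_pi_lt_arg (y : ℂ)
  have hy' := Complex.arg_le_pi (y : ℂ)
  rw [← Circle.exp_arg x, ← Circle.exp_arg y]
  congr 1
  rcases lt_trichotomy (Complex.arg (x : ℂ)) (Complex.arg (y : ℂ)) with h | h | h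
  · exact (key _ _ h (by linarith) hxy).elim
  · exact h
  · exact (key _ _ h (by linarith) hxy.symm).elim

variable {H : ℂ → ℝ} {U : ℝ → ℂ}

/-- Bootstrap: the right-hand side of the equation is as regular as `U`, up to class `C¹`. -/
lemma contDiff_two_of_ode (hH : ContDiff ℝ 1 H) (hpos : ∀ t, 0 < H (U t))
    (hU : ∀ t, HasDerivAt U ((H (U t))⁻¹ • (Complex.I * unitVec t)) t) : ContDiff ℝ 2 U := by
  have hdU : deriv U = fun t => (H (U t))⁻¹ • (Complex.I * unitVec t) :=
    funext fun t => (hU t).deriv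
  have hdiff : Differentiable ℝ U := fun t => (hU t).differentiableAt
  have step : ∀ n : WithTop ℕ∞, n ≤ 1 → n ≠ ⊤ → ContDiff ℝ n U → ContDiff ℝ (n + 1) U := by
    intro n hn hn' h
    rw [contDiff_succ_iff_deriv]
    refine ⟨hdiff, fun h => (hn' h).elim, ?_⟩
    rw [hdU]
    exact (((hH.of_le hn).comp h).inv fun t => (hpos t).ne').smul
      (contDiff_const.mul contDiff_unitVec)
  have h0 : ContDiff ℝ 0 U := contDiff_zero.2 hdiff.continuous
  have h1 : ContDiff ℝ 1 U := by simpa using step 0 zero_le_one (by simp) h0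
  have h2 := step 1 le_rfl (by simp) h1
  rwa [one_add_one_eq_two] at h2

lemma hasDerivAt_deriv_of_ode (hH : ContDiff ℝ 1 H) (hpos : ∀ t, 0 < H (U t))
    (hU : ∀ t, HasDerivAt U ((H (U t))⁻¹ • (Complex.I * unitVec t)) t) (t : ℝ) :
    HasDerivAt (deriv U) ((H (U t))⁻¹ • (Complex.I * (Complex.I * unitVec t)) +
      (-(fderiv ℝ H (U t) (deriv U t)) / H (U t) ^ 2) • (Complex.I * unitVec t)) t := by
  have hdU : deriv U = fun t => (H (U t))⁻¹ • (Complex.I * unitVec t) :=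
    funext fun t => (hU t).deriv
  have hHU := ((hH.differentiable one_ne_zero (U t)).hasFDerivAt).comp_hasDerivAt t
    (hU t).differentiableAt.hasDerivAt
  have h := (hHU.inv (hpos t).ne').smul ((hasDerivAt_unitVec t).const_mul Complex.I)
  rw [hdU]
  rw [hdU] at h
  exact h

/-- The derivative of the speed contributes only a tangential term to `U''`, orthogonal to `i U'`.
The curvature is therefore the reciprocal of the speed. -/
lemma curvature_of_ode (hH : ContDiff ℝ 1 H) (hpos : ∀ t, 0 < H (U t))
    (hU : ∀ t, HasDerivAt U ((H (U t))⁻¹ • (Complex.I * unitVec t)) t) (t : ℝ) :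
    inner ℝ (deriv (deriv U) t) (Complex.I * deriv U t) / ‖deriv U t‖ ^ 3 = H (U t) := by
  have h := hpos t
  rw [(hasDerivAt_deriv_of_ode hH hpos hU t).deriv, (hU t).deriv, mul_smul_comm,
    inner_add_left, inner_smul_left, inner_smul_left, inner_smul_right, inner_smul_right,
    norm_smul, norm_mul, norm_unitVec, Complex.norm_I, Real.norm_of_nonneg (inv_pos.2 h).le]
  have h1 : inner ℝ (Complex.I * (Complex.I * unitVec t)) (Complex.I * (Complex.I * unitVec t)) =
      (1 : ℝ) := by
    rw [real_inner_self_eq_norm_sq]; simp [norm_unitVec]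
  have h2 : inner ℝ (Complex.I * unitVec t) (Complex.I * (Complex.I * unitVec t)) = (0 : ℝ) := by
    simp [Complex.inner]; ring
  rw [h1, h2]
  simp only [mul_one, mul_zero, add_zero, conj_trivial]
  field_simp

/-- A closed solution of the equation of `H`-loops in the tangent angle is an embedded
`H`-loop. -/
lemma isEmbeddedLoop_of_ode (hH : ContDiff ℝ 1 H) (hpos : ∀ t, 0 < H (U t))
    (hU : ∀ t, HasDerivAt U ((H (U t))⁻¹ • (Complex.I * unitVec t)) t)
    (hper : Function.Periodic U (2 * Real.pi)) : IsEmbeddedLoop H (circleCurve U) := by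
  have hlift := angleLift_circleCurve hper
  have hcont : Continuous U := (contDiff_two_of_ode hH hpos hU).continuous
  refine ⟨⟨?_, fun t => ?_⟩, ?_, fun t => ?_⟩
  · rw [hlift]; exact contDiff_two_of_ode hH hpos hU
  · rw [hlift, (hU t).deriv]
    exact smul_ne_zero (inv_ne_zero (hpos t).ne') (mul_ne_zero Complex.I_ne_zero (unitVec_ne_zero t))
  · exact circleCurve_injective
      ((hH.continuous.comp hcont).inv₀ fun t => (hpos t).ne') (fun t => inv_pos.2 (hpos t)) hU hper
  · have h : circleCurve U (Circle.exp t) = U t := congrFun hlift t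
    rw [curveCurvature, hlift, h]
    exact curvature_of_ode hH hpos hU t

end Curves

/-! ### The equation modulo constants, solved by contraction -/

section Velocities

/-- The primitive of `v` with mean zero over `[0, 2π]`. -/
noncomputable def meanFreePrimitive (v : ℝ → ℂ) (t : ℝ) : ℂ :=
  (∫ s in (0 : ℝ)..t, v s) - (2 * Real.pi)⁻¹ • ∫ r in (0 : ℝ)..(2 * Real.pi), ∫ s in (0 : ℝ)..r, v s

/-- Continuous `2π`-periodic functions with mean zero and values of norm at most `ρ`. -/
structure IsVelocity (ρ : ℝ) (v : ℝ → ℂ) : Prop where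
  continuous : Continuous v
  periodic : Function.Periodic v (2 * Real.pi)
  integral_eq_zero : ∫ t in (0 : ℝ)..(2 * Real.pi), v t = 0
  norm_le : ∀ t, ‖v t‖ ≤ ρ

lemma hasDerivAt_meanFreePrimitive {v : ℝ → ℂ} (hv : Continuous v) (t : ℝ) :
    HasDerivAt (meanFreePrimitive v) (v t) t :=
  (intervalIntegral.integral_hasDerivAt_right (hv.intervalIntegrable 0 t)
    hv.aestronglyMeasurable.stronglyMeasurableAtFilter hv.continuousAt).sub_const _

lemma continuous_meanFreePrimitive {v : ℝ → ℂ} (hv : Continuous v) :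
    Continuous (meanFreePrimitive v) :=
  continuous_iff_continuousAt.2 fun t => (hasDerivAt_meanFreePrimitive hv t).continuousAt

lemma meanFreePrimitive_periodic {ρ : ℝ} {v : ℝ → ℂ} (hv : IsVelocity ρ v) :
    Function.Periodic (meanFreePrimitive v) (2 * Real.pi) := fun t => by
  have hi : ∀ a b, IntervalIntegrable v MeasureTheory.volume a b :=
    fun a b => hv.continuous.intervalIntegrable a b
  have h1 := intervalIntegral.integral_add_adjacent_intervals (hi 0 t) (hi t (t + 2 * Real.pi))
  have h2 := hv.periodic.intervalIntegral_add_eq t 0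
  rw [zero_add, hv.integral_eq_zero] at h2
  rw [h2, add_zero] at h1
  rw [meanFreePrimitive, meanFreePrimitive, h1]

lemma continuous_primitive {v : ℝ → ℂ} (hv : Continuous v) :
    Continuous (fun r => ∫ s in (0 : ℝ)..r, v s) :=
  intervalIntegral.continuous_primitive (fun a b => hv.intervalIntegrable a b) 0

lemma integral_meanFreePrimitive {v : ℝ → ℂ} (hv : Continuous v) :
    ∫ t in (0 : ℝ)..(2 * Real.pi), meanFreePrimitive v t = 0 := by
  unfold meanFreePrimitive
  rw [intervalIntegral.integral_sub ((continuous_primitive hv).intervalIntegrable _ _)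
    intervalIntegrable_const, intervalIntegral.integral_const, smul_smul, sub_zero,
    mul_inv_cancel₀ Real.two_pi_pos.ne', one_smul, sub_self]

lemma meanFreePrimitive_sub {v w : ℝ → ℂ} (hv : Continuous v) (hw : Continuous w) (t : ℝ) :
    meanFreePrimitive v t - meanFreePrimitive w t = meanFreePrimitive (fun s => v s - w s) t := by
  have h : ∀ r, ∫ s in (0 : ℝ)..r, (v s - w s) =
      (∫ s in (0 : ℝ)..r, v s) - ∫ s in (0 : ℝ)..r, w s := fun r =>
    intervalIntegral.integral_sub (hv.intervalIntegrable _ _) (hw.intervalIntegrable _ _)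
  simp only [meanFreePrimitive, h]
  rw [intervalIntegral.integral_sub ((continuous_primitive hv).intervalIntegrable _ _)
    ((continuous_primitive hw).intervalIntegrable _ _), smul_sub]
  ring

lemma norm_meanFreePrimitive_le {ρ : ℝ} {v : ℝ → ℂ} (hv : IsVelocity ρ v) (t : ℝ) :
    ‖meanFreePrimitive v t‖ ≤ 4 * Real.pi * ρ := by
  have hπ := Real.two_pi_pos
  have hρ : 0 ≤ ρ := (norm_nonneg _).trans (hv.norm_le 0)
  obtain ⟨s, hs, hts⟩ := (meanFreePrimitive_periodic hv).exists_mem_Ico₀ hπ t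
  rw [hts]
  have h1 : ∀ r ∈ Set.Icc 0 (2 * Real.pi), ‖∫ s in (0 : ℝ)..r, v s‖ ≤ 2 * Real.pi * ρ := by
    intro r hr
    have := intervalIntegral.norm_integral_le_of_norm_le_const (a := 0) (b := r)
      (fun x _ => hv.norm_le x)
    rw [sub_zero, abs_of_nonneg hr.1, mul_comm] at this
    exact this.trans (mul_le_mul_of_nonneg_right hr.2 hρ)
  have h2 : ‖∫ r in (0 : ℝ)..(2 * Real.pi), ∫ s in (0 : ℝ)..r, v s‖ ≤
      2 * Real.pi * ρ * (2 * Real.pi) := by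
    have := intervalIntegral.norm_integral_le_of_norm_le_const (a := 0) (b := 2 * Real.pi)
      (f := fun r => ∫ s in (0 : ℝ)..r, v s) (fun x hx => by
        rw [Set.uIoc_of_le hπ.le] at hx
        exact h1 x ⟨hx.1.le, hx.2⟩)
    rwa [sub_zero, abs_of_pos hπ] at this
  calc ‖meanFreePrimitive v s‖ ≤ _ := norm_sub_le _ _
    _ ≤ 2 * Real.pi * ρ + (2 * Real.pi)⁻¹ * (2 * Real.pi * ρ * (2 * Real.pi)) := by
        rw [norm_smul, Real.norm_of_nonneg (inv_pos.2 hπ).le]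
        exact add_le_add (h1 s ⟨hs.1, hs.2.le⟩)
          (mul_le_mul_of_nonneg_left h2 (inv_pos.2 hπ).le)
    _ = 4 * Real.pi * ρ := by field_simp; ring

lemma integral_unitVec : ∫ t in (0 : ℝ)..(2 * Real.pi), unitVec t = 0 := by
  have h : ∀ t, HasDerivAt (fun t => -Complex.I * unitVec t) (unitVec t) t := fun t => by
    have := (hasDerivAt_unitVec t).const_mul (-Complex.I)
    rwa [← mul_assoc, neg_mul, Complex.I_mul_I, neg_neg, one_mul] at this
  rw [intervalIntegral.integral_eq_sub_of_hasDerivAt (fun t _ => h t)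
    (continuous_unitVec.intervalIntegrable _ _)]
  have := unitVec_periodic 0
  rw [zero_add] at this
  rw [this, sub_self]

lemma isVelocity_circle {c : ℝ} (hc : 0 ≤ c) :
    IsVelocity c (fun t => c • (Complex.I * unitVec t)) where
  continuous := (continuous_const.mul continuous_unitVec).const_smul c
  periodic := fun t => by simp only [unitVec_periodic t]
  integral_eq_zero := by
    rw [intervalIntegral.integral_smul, intervalIntegral.integral_const_mul, integral_unitVec,
      mul_zero, smul_zero]
  norm_le := fun t => by simp [norm_unitVec, abs_of_nonneg hc]

lemma meanFreePrimitive_circle (c t : ℝ) :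
    meanFreePrimitive (fun t => c • (Complex.I * unitVec t)) t = c • unitVec t := by
  have h : ∀ r, ∫ s in (0 : ℝ)..r, c • (Complex.I * unitVec s) = c • unitVec r - c • unitVec 0 :=
    fun r => intervalIntegral.integral_eq_sub_of_hasDerivAt
      (fun t _ => (hasDerivAt_unitVec t).const_smul c)
      (((continuous_const.mul continuous_unitVec).const_smul c).intervalIntegrable _ _)
  have hc : Continuous (fun r => c • unitVec r) := continuous_unitVec.const_smul c
  simp only [meanFreePrimitive, h]
  rw [intervalIntegral.integral_sub (hc.intervalIntegrable _ _)
    intervalIntegrable_const, intervalIntegral.integral_smul, integral_unitVec,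
    intervalIntegral.integral_const, smul_zero, zero_sub, sub_zero, smul_neg, smul_smul,
    inv_mul_cancel₀ Real.two_pi_pos.ne', one_smul]
  ring

lemma IsVelocity.sub {ρ ρ' d : ℝ} {v w : ℝ → ℂ} (hv : IsVelocity ρ v) (hw : IsVelocity ρ' w)
    (hd : ∀ t, ‖v t - w t‖ ≤ d) : IsVelocity d (fun t => v t - w t) where
  continuous := hv.continuous.sub hw.continuous
  periodic := fun t => by simp only [hv.periodic t, hw.periodic t]
  integral_eq_zero := by
    rw [intervalIntegral.integral_sub (hv.continuous.intervalIntegrable _ _)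
      (hw.continuous.intervalIntegrable _ _), hv.integral_eq_zero, hw.integral_eq_zero, sub_zero]
  norm_le := hd

lemma norm_meanFreePrimitive_sub_le {ρ ρ' d : ℝ} {v w : ℝ → ℂ} (hv : IsVelocity ρ v)
    (hw : IsVelocity ρ' w) (hd : ∀ t, ‖v t - w t‖ ≤ d) (t : ℝ) :
    ‖meanFreePrimitive v t - meanFreePrimitive w t‖ ≤ 4 * Real.pi * d := by
  rw [meanFreePrimitive_sub hv.continuous hw.continuous]
  exact norm_meanFreePrimitive_le (hv.sub hw hd) t

/-- `K` is bounded by `M` and `M`-Lipschitz in the closed ball of radius `r`. -/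
structure BoundedLipschitz (K : ℂ → ℝ) (r M : ℝ) : Prop where
  nonneg : 0 ≤ M
  bound : ∀ a ∈ Metric.closedBall (0 : ℂ) r, |K a| ≤ M
  lipschitz : ∀ a ∈ Metric.closedBall (0 : ℂ) r, ∀ b ∈ Metric.closedBall (0 : ℂ) r,
    |K b - K a| ≤ M * ‖b - a‖

/-- The closed curve of mean value `z` and derivative `v`. -/
noncomputable def curveOf (z : ℂ) (v : ℝ → ℂ) (t : ℝ) : ℂ := z + meanFreePrimitive v t

/-- The mean over `[0, 2π]`. -/
noncomputable def mean (w : ℝ → ℂ) : ℂ := (2 * Real.pi)⁻¹ • ∫ t in (0 : ℝ)..(2 * Real.pi), w t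

lemma norm_mean_le {w : ℝ → ℂ} {c : ℝ} (hw : ∀ t, ‖w t‖ ≤ c) : ‖mean w‖ ≤ c := by
  have hπ := Real.two_pi_pos
  have := intervalIntegral.norm_integral_le_of_norm_le_const (a := 0) (b := 2 * Real.pi)
    (fun x _ => hw x)
  rw [sub_zero, abs_of_pos hπ] at this
  rw [mean, norm_smul, Real.norm_of_nonneg (inv_pos.2 hπ).le, inv_mul_le_iff₀ hπ]
  linarith

lemma mean_sub {v w : ℝ → ℂ} (hv : Continuous v) (hw : Continuous w) :
    mean v - mean w = mean (fun t => v t - w t) := by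
  rw [mean, mean, mean, intervalIntegral.integral_sub (hv.intervalIntegrable _ _)
    (hw.intervalIntegrable _ _), smul_sub]

/-- The derivative of the curve of mean value `z` and derivative `v`, weighted by `K`. -/
noncomputable def weighted (K : ℂ → ℝ) (z : ℂ) (v : ℝ → ℂ) (t : ℝ) : ℂ := K (curveOf z v t) • v t

variable {K : ℂ → ℝ} {R M ρ : ℝ} {z z' : ℂ} {v v' : ℝ → ℂ}

/-- The radius 26 comes from `4π · 2 < 26`. -/
lemma curveOf_mem (hz : ‖z‖ ≤ R) (hρ : ρ ≤ 2) (hv : IsVelocity ρ v) (t : ℝ) :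
    curveOf z v t ∈ Metric.closedBall (0 : ℂ) (R + 26) := by
  have h := norm_meanFreePrimitive_le hv t
  have hπ := Real.pi_lt_d2
  have hπ' := Real.pi_pos
  rw [mem_closedBall_zero_iff]
  refine (norm_add_le _ _).trans (add_le_add hz (h.trans ?_))
  nlinarith

lemma hasDerivAt_curveOf (z : ℂ) (hv : Continuous v) (t : ℝ) :
    HasDerivAt (curveOf z v) (v t) t := (hasDerivAt_meanFreePrimitive hv t).const_add z

lemma continuous_curveOf (z : ℂ) (hv : Continuous v) : Continuous (curveOf z v) :=
  continuous_const.add (continuous_meanFreePrimitive hv)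

lemma curveOf_periodic (z : ℂ) (hv : IsVelocity ρ v) :
    Function.Periodic (curveOf z v) (2 * Real.pi) := fun t => by
  rw [curveOf, curveOf, meanFreePrimitive_periodic hv t]

lemma continuous_weighted (hK : Continuous K) (z : ℂ) (hv : Continuous v) :
    Continuous (weighted K z v) := (hK.comp (continuous_curveOf z hv)).smul hv

lemma norm_weighted_le (hM : BoundedLipschitz K (R + 26) M) (hz : ‖z‖ ≤ R) (hρ : ρ ≤ 2)
    (hv : IsVelocity ρ v) (t : ℝ) : ‖weighted K z v t‖ ≤ M * ρ := by
  rw [weighted, norm_smul]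
  exact mul_le_mul (hM.bound _ (curveOf_mem hz hρ hv t)) (hv.norm_le t) (norm_nonneg _) hM.nonneg

lemma norm_curveOf_sub_le {ρ' d : ℝ} (z z' : ℂ) (hv : IsVelocity ρ v) (hv' : IsVelocity ρ' v')
    (hd : ∀ t, ‖v t - v' t‖ ≤ d) (t : ℝ) :
    ‖curveOf z v t - curveOf z' v' t‖ ≤ ‖z - z'‖ + 4 * Real.pi * d := by
  have h : curveOf z v t - curveOf z' v' t =
      (z - z') + (meanFreePrimitive v t - meanFreePrimitive v' t) := by
    simp only [curveOf]; ring
  rw [h]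
  exact (norm_add_le _ _).trans
    (add_le_add le_rfl (norm_meanFreePrimitive_sub_le hv hv' hd t))

/-- Product rule: the change of `K` costs `2M(‖z - z'‖ + 4πd)` and the change of velocity costs
`Md`; finally `8π + 1 < 27`. -/
lemma norm_weighted_sub_le {d : ℝ} (hM : BoundedLipschitz K (R + 26) M) (hz : ‖z‖ ≤ R)
    (hz' : ‖z'‖ ≤ R) (hρ : ρ ≤ 2) (hv : IsVelocity ρ v) (hv' : IsVelocity ρ v')
    (hd : ∀ t, ‖v t - v' t‖ ≤ d) (t : ℝ) :
    ‖weighted K z v t - weighted K z' v' t‖ ≤ M * (2 * ‖z - z'‖ + 27 * d) := by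
  have h0 := hM.nonneg
  have hd0 : 0 ≤ d := (norm_nonneg _).trans (hd 0)
  have hc := norm_curveOf_sub_le z z' hv hv' hd t
  have h : weighted K z v t - weighted K z' v' t =
      (K (curveOf z v t) - K (curveOf z' v' t)) • v t +
        K (curveOf z' v' t) • (v t - v' t) := by
    simp only [weighted, sub_smul, smul_sub]; ring
  have h1 : ‖(K (curveOf z v t) - K (curveOf z' v' t)) • v t‖ ≤
      M * (‖z - z'‖ + 4 * Real.pi * d) * 2 := by
    rw [norm_smul]
    refine mul_le_mul ?_ ((hv.norm_le t).trans hρ) (norm_nonneg _) ?_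
    · exact (hM.lipschitz _ (curveOf_mem hz' hρ hv' t) _ (curveOf_mem hz hρ hv t)).trans
        (mul_le_mul_of_nonneg_left hc h0)
    · exact mul_nonneg h0 ((norm_nonneg _).trans hc)
  have h2 : ‖K (curveOf z' v' t) • (v t - v' t)‖ ≤ M * d := by
    rw [norm_smul]
    exact mul_le_mul (hM.bound _ (curveOf_mem hz' hρ hv' t)) (hd t) (norm_nonneg _) h0
  rw [h]
  refine (norm_add_le _ _).trans ((add_le_add h1 h2).trans ?_)
  have hπ := Real.pi_lt_d2
  have : M * d * Real.pi ≤ M * d * 3.15 := mul_le_mul_of_nonneg_left hπ.le (mul_nonneg h0 hd0)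
  nlinarith [mul_nonneg h0 hd0]

/-- The map whose fixed points `v` are the derivatives of the curves `u` with mean `z` for which
`(k + ε K(u)) u'` differs from `i e^{it}` by a constant. -/
noncomputable def velocityMap (K : ℂ → ℝ) (k ε : ℝ) (z : ℂ) (v : ℝ → ℂ) (t : ℝ) : ℂ :=
  k⁻¹ • (Complex.I * unitVec t - ε • (weighted K z v t - mean (weighted K z v)))

variable {k ε : ℝ}

lemma isVelocity_velocityMap (hK : Continuous K) (hM : BoundedLipschitz K (R + 26) M)
    (hz : ‖z‖ ≤ R) (hk : 1 ≤ k) (hε : |ε| * (120 * M) ≤ 1) (hv : IsVelocity (2 * k⁻¹) v) :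
    IsVelocity (2 * k⁻¹) (velocityMap K k ε z v) := by
  have hk0 : 0 < k := one_pos.trans_le hk
  have hk1 : k⁻¹ ≤ 1 := inv_le_one_of_one_le₀ hk
  have hρ : 2 * k⁻¹ ≤ 2 := by linarith
  have hw := norm_weighted_le hM hz hρ hv
  have hw' : ∀ t, ‖weighted K z v t‖ ≤ M * 2 :=
    fun t => (hw t).trans (mul_le_mul_of_nonneg_left hρ hM.nonneg)
  have hcw := continuous_weighted hK z hv.continuous
  have hcI : Continuous (fun t => Complex.I * unitVec t) := continuous_const.mul continuous_unitVec
  have hcm : Continuous (fun t => ε • (weighted K z v t - mean (weighted K z v))) :=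
    (hcw.sub continuous_const).const_smul ε
  refine ⟨?_, fun t => ?_, ?_, fun t => ?_⟩
  · exact (hcI.sub hcm).const_smul k⁻¹
  · simp only [velocityMap, unitVec_periodic t, weighted, curveOf_periodic z hv t, hv.periodic t]
  · unfold velocityMap
    rw [intervalIntegral.integral_smul, intervalIntegral.integral_sub
      (hcI.intervalIntegrable _ _) (hcm.intervalIntegrable _ _),
      intervalIntegral.integral_const_mul, integral_unitVec, intervalIntegral.integral_smul,
      intervalIntegral.integral_sub (hcw.intervalIntegrable _ _) intervalIntegrable_const,
      intervalIntegral.integral_const, mean, smul_smul, sub_zero,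
      mul_inv_cancel₀ Real.two_pi_pos.ne', one_smul, sub_self, smul_zero, mul_zero, sub_zero,
      smul_zero]
  · rw [velocityMap, norm_smul, Real.norm_of_nonneg (inv_pos.2 hk0).le, mul_comm]
    refine mul_le_mul_of_nonneg_right ?_ (inv_pos.2 hk0).le
    refine (norm_sub_le _ _).trans ?_
    rw [norm_mul, Complex.norm_I, norm_unitVec, norm_smul, Real.norm_eq_abs]
    have h1 : ‖weighted K z v t - mean (weighted K z v)‖ ≤ M * 2 + M * 2 :=
      (norm_sub_le _ _).trans (add_le_add (hw' t) (norm_mean_le hw'))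
    have h2 := mul_le_mul_of_nonneg_left h1 (abs_nonneg ε)
    nlinarith [mul_nonneg (abs_nonneg ε) hM.nonneg]

/-- Subtracting the mean at most doubles the estimate for `weighted`. The factor is then `54 |ε| M`,
and the constant 120 in the smallness condition makes it less than `1/2`. -/
lemma norm_velocityMap_sub_le {d : ℝ} (hK : Continuous K) (hM : BoundedLipschitz K (R + 26) M)
    (hz : ‖z‖ ≤ R) (hz' : ‖z'‖ ≤ R) (hk : 1 ≤ k) (hε : |ε| * (120 * M) ≤ 1)
    (hv : IsVelocity (2 * k⁻¹) v) (hv' : IsVelocity (2 * k⁻¹) v')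
    (hd : ∀ t, ‖v t - v' t‖ ≤ d) (t : ℝ) :
    ‖velocityMap K k ε z v t - velocityMap K k ε z' v' t‖ ≤ 2⁻¹ * (‖z - z'‖ + d) := by
  have hk0 : 0 < k := one_pos.trans_le hk
  have hk1 : k⁻¹ ≤ 1 := inv_le_one_of_one_le₀ hk
  have hρ : 2 * k⁻¹ ≤ 2 := by linarith
  have hd0 : 0 ≤ d := (norm_nonneg _).trans (hd 0)
  have hw := norm_weighted_sub_le hM hz hz' hρ hv hv' hd
  have hm := norm_mean_le hw
  rw [← mean_sub (continuous_weighted hK z hv.continuous)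
    (continuous_weighted hK z' hv'.continuous)] at hm
  have h : velocityMap K k ε z v t - velocityMap K k ε z' v' t =
      k⁻¹ • (-(ε • ((weighted K z v t - weighted K z' v' t) -
        (mean (weighted K z v) - mean (weighted K z' v'))))) := by
    simp only [velocityMap, ← smul_sub]
    congr 1
    simp only [smul_sub]
    ring
  rw [h, norm_smul, norm_neg, norm_smul, Real.norm_of_nonneg (inv_pos.2 hk0).le,
    Real.norm_eq_abs]
  have h1 := (norm_sub_le _ _).trans (add_le_add (hw t) hm)
  have h2 := mul_le_mul_of_nonneg_left h1 (abs_nonneg ε)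
  refine (mul_le_of_le_one_left (by positivity) hk1).trans (h2.trans ?_)
  have h3 : 0 ≤ ‖z - z'‖ + d := by positivity
  nlinarith [mul_le_mul_of_nonneg_right hε h3, mul_nonneg (mul_nonneg (abs_nonneg ε) hM.nonneg)
    (norm_nonneg (z - z')), mul_nonneg (mul_nonneg (abs_nonneg ε) hM.nonneg) hd0]

lemma isClosed_isVelocity (ρ : ℝ) :
    IsClosed {v : BoundedContinuousFunction ℝ ℂ | IsVelocity ρ v} := by
  have hev : ∀ t : ℝ, Continuous (fun v : BoundedContinuousFunction ℝ ℂ => v t) :=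
    fun t => continuous_eval_const t
  have hint : Continuous (fun v : BoundedContinuousFunction ℝ ℂ =>
      ∫ t in (0 : ℝ)..(2 * Real.pi), v t) := by
    refine (LipschitzWith.of_dist_le_mul (K := Real.toNNReal (2 * Real.pi)) fun v w => ?_).continuous
    rw [dist_eq_norm, dist_eq_norm, ← intervalIntegral.integral_sub
      (v.continuous.intervalIntegrable _ _) (w.continuous.intervalIntegrable _ _),
      Real.coe_toNNReal _ Real.two_pi_pos.le]
    have := intervalIntegral.norm_integral_le_of_norm_le_const (a := 0) (b := 2 * Real.pi)
      (fun x _ => (v - w).norm_coe_le_norm x)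
    rwa [sub_zero, abs_of_pos Real.two_pi_pos, mul_comm ‖v - w‖] at this
  have h : {v : BoundedContinuousFunction ℝ ℂ | IsVelocity ρ v} =
      (⋂ t : ℝ, {v | v (t + 2 * Real.pi) = v t}) ∩
        ({v | ∫ t in (0 : ℝ)..(2 * Real.pi), v t = 0} ∩ ⋂ t : ℝ, {v | ‖v t‖ ≤ ρ}) := by
    ext v
    simp only [Set.mem_ofPred_eq, Set.mem_inter_iff, Set.mem_iInter]
    exact ⟨fun h => ⟨h.periodic, h.integral_eq_zero, h.norm_le⟩,
      fun h => ⟨v.continuous, h.1, h.2.1, h.2.2⟩⟩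
  rw [h]
  exact (isClosed_iInter fun t => isClosed_eq (hev _) (hev _)).inter
    ((isClosed_eq hint continuous_const).inter
      (isClosed_iInter fun t => isClosed_le (hev t).norm continuous_const))

lemma exists_fixed_velocity (hK : Continuous K) (hM : BoundedLipschitz K (R + 26) M)
    (hz : ‖z‖ ≤ R) (hk : 1 ≤ k) (hε : |ε| * (120 * M) ≤ 1) :
    ∃ v, IsVelocity (2 * k⁻¹) v ∧ velocityMap K k ε z v = v := by
  have hk0 : 0 < k := one_pos.trans_le hk
  let S : Set (BoundedContinuousFunction ℝ ℂ) := {v | IsVelocity (2 * k⁻¹) v}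
  have : CompleteSpace S := (isClosed_isVelocity _).completeSpace_coe
  have hvel : ∀ w : ℝ → ℂ, (hw : IsVelocity (2 * k⁻¹) w) →
      IsVelocity (2 * k⁻¹) (BoundedContinuousFunction.ofNormedAddCommGroup w hw.continuous
        (2 * k⁻¹) hw.norm_le) := fun w hw => hw
  have : Nonempty S := by
    have h0 : IsVelocity (2 * k⁻¹) (fun _ => 0) :=
      ⟨continuous_const, fun t => rfl, by simp, fun t => by simp; positivity⟩
    exact ⟨⟨_, hvel _ h0⟩⟩
  have hmap : ∀ v : S, IsVelocity (2 * k⁻¹) (velocityMap K k ε z v.1) :=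
    fun v => isVelocity_velocityMap hK hM hz hk hε v.2
  let T : S → S := fun v => ⟨_, hvel _ (hmap v)⟩
  have hT : ContractingWith (2⁻¹ : NNReal) T := by
    refine ⟨by norm_num, LipschitzWith.of_dist_le_mul fun v w => ?_⟩
    rw [Subtype.dist_eq, Subtype.dist_eq, BoundedContinuousFunction.dist_le (by positivity)]
    intro t
    rw [dist_eq_norm]
    have := norm_velocityMap_sub_le hK hM hz hz hk hε v.2 w.2
      (fun s => (dist_eq_norm (v.1 s) (w.1 s)) ▸ BoundedContinuousFunction.dist_coe_le_dist s) t
    rw [sub_self, norm_zero, zero_add] at this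
    exact this
  refine ⟨_, (ContractingWith.fixedPoint T hT).2, ?_⟩
  have h := hT.fixedPoint_isFixedPt
  ext t
  exact DFunLike.congr_fun (congrArg Subtype.val h) t

/-- The supremum `S` of the difference satisfies `S ≤ (‖z - z'‖ + S)/2`. This Lipschitz dependence
on the mean is all that the differentiability of the reduced action needs. -/
lemma norm_fixed_velocity_sub_le (hK : Continuous K) (hM : BoundedLipschitz K (R + 26) M)
    (hz : ‖z‖ ≤ R) (hz' : ‖z'‖ ≤ R) (hk : 1 ≤ k) (hε : |ε| * (120 * M) ≤ 1)
    (hv : IsVelocity (2 * k⁻¹) v) (hv' : IsVelocity (2 * k⁻¹) v')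
    (hfix : velocityMap K k ε z v = v) (hfix' : velocityMap K k ε z' v' = v') (t : ℝ) :
    ‖v t - v' t‖ ≤ ‖z - z'‖ := by
  have hbdd : BddAbove (Set.range fun t => ‖v t - v' t‖) :=
    ⟨2 * k⁻¹ + 2 * k⁻¹, by
      rintro _ ⟨t, rfl⟩
      exact (norm_sub_le _ _).trans (add_le_add (hv.norm_le t) (hv'.norm_le t))⟩
  have hle : ∀ t, ‖v t - v' t‖ ≤ ⨆ t, ‖v t - v' t‖ := fun t => le_ciSup hbdd t
  have h : ⨆ t, ‖v t - v' t‖ ≤ 2⁻¹ * (‖z - z'‖ + ⨆ t, ‖v t - v' t‖) := by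
    refine ciSup_le fun s => ?_
    have := norm_velocityMap_sub_le hK hM hz hz' hk hε hv hv' hle s
    rwa [hfix, hfix'] at this
  linarith [hle t]

/-- The correction to the circular velocity carries one factor `k⁻¹` from the map and another from
the size of `v`. The second makes the error negligible after the gradient is rescaled by `k²`. -/
lemma norm_fixed_velocity_sub_circle_le (hM : BoundedLipschitz K (R + 26) M)
    (hz : ‖z‖ ≤ R) (hk : 1 ≤ k) (hε : |ε| * (120 * M) ≤ 1)
    (hv : IsVelocity (2 * k⁻¹) v) (hfix : velocityMap K k ε z v = v) (t : ℝ) :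
    ‖v t - k⁻¹ • (Complex.I * unitVec t)‖ ≤ k⁻¹ ^ 2 := by
  have hk0 : 0 < k := one_pos.trans_le hk
  have hki : 0 < k⁻¹ := inv_pos.2 hk0
  have hk1 : k⁻¹ ≤ 1 := inv_le_one_of_one_le₀ hk
  have hw := norm_weighted_le hM hz (by linarith) hv
  have h : v t - k⁻¹ • (Complex.I * unitVec t) =
      -(k⁻¹ • ε • (weighted K z v t - mean (weighted K z v))) := by
    conv_lhs => rw [← hfix]
    rw [velocityMap, smul_sub]; ring
  rw [h, norm_neg, norm_smul, norm_smul, Real.norm_of_nonneg hki.le, Real.norm_eq_abs, sq]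
  refine mul_le_mul_of_nonneg_left ?_ hki.le
  have h1 := (norm_sub_le _ _).trans (add_le_add (hw t) (norm_mean_le hw))
  have h2 := mul_le_mul_of_nonneg_left h1 (abs_nonneg ε)
  refine h2.trans ?_
  nlinarith [mul_le_mul_of_nonneg_right hε hki.le]

lemma fixed_velocity_equation (hk : 0 < k) (hfix : velocityMap K k ε z v = v) (t : ℝ) :
    (k + ε * K (curveOf z v t)) • v t =
      Complex.I * unitVec t + ε • mean (weighted K z v) := by
  have h : k • v t = Complex.I * unitVec t - ε • (weighted K z v t - mean (weighted K z v)) := by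
    conv_lhs => rw [← hfix]
    rw [velocityMap, smul_smul, mul_inv_cancel₀ hk.ne', one_smul]
  rw [add_smul, h, mul_smul, smul_sub, weighted]
  ring

end Velocities

/-! ### The variational structure and the reduced action -/

section Action

/-- The functional whose critical points among closed curves `U` with derivative `V` are the
solutions of `H(U) V = i e^{it}`. -/
noncomputable def action (H : ℂ → ℝ) (U V : ℝ → ℂ) : ℝ :=
  ∫ t in (0 : ℝ)..(2 * Real.pi), (rePrimitive H (U t) * (V t).im - inner ℝ (unitVec t) (U t))

/-- Integration by parts moves the variation of the velocity onto the curve. The remainder is the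
Taylor error of the primitive plus a product of two increments, so no differentiability of the
family of curves is required. -/
lemma first_variation {H : ℂ → ℝ} (hH : ContDiff ℝ 1 H) {U V U' V' : ℝ → ℂ}
    (hU : ∀ t, HasDerivAt U (V t) t) (hU' : ∀ t, HasDerivAt U' (V' t) t)
    (hV : Continuous V) (hV' : Continuous V')
    (hper : Function.Periodic U (2 * Real.pi)) (hper' : Function.Periodic U' (2 * Real.pi))
    {η L c ρ : ℝ}
    (htaylor : ∀ t, |rePrimitive H (U' t) - rePrimitive H (U t) -
      fderiv ℝ (rePrimitive H) (U t) (U' t - U t)| ≤ η * c)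
    (hlip : ∀ t, |rePrimitive H (U' t) - rePrimitive H (U t)| ≤ L * c)
    (hVρ : ∀ t, ‖V t‖ ≤ ρ) (hVV : ∀ t, ‖V' t - V t‖ ≤ c) :
    |action H U' V' - action H U V - ∫ t in (0 : ℝ)..(2 * Real.pi),
      inner ℝ (-Complex.I * (H (U t) • V t) - unitVec t) (U' t - U t)| ≤
      (η * c * ρ + L * c * c) * (2 * Real.pi) := by
  set X := rePrimitive H
  have hX : ContDiff ℝ 1 X := contDiff_rePrimitive hH
  have hXc := hX.continuous
  have hdX : Continuous (fderiv ℝ X) := hX.continuous_fderiv one_ne_zero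
  have hHc := hH.continuous
  have hUc : Continuous U := continuous_iff_continuousAt.2 fun t => (hU t).continuousAt
  have hUc' : Continuous U' := continuous_iff_continuousAt.2 fun t => (hU' t).continuousAt
  have he := continuous_unitVec
  have cF : Continuous (fun t => X (U t) * (V t).im - inner ℝ (unitVec t) (U t)) := by fun_prop
  have cF' : Continuous (fun t => X (U' t) * (V' t).im - inner ℝ (unitVec t) (U' t)) := by
    fun_prop
  have cG : Continuous (fun t =>
      inner ℝ (-Complex.I * (H (U t) • V t) - unitVec t) (U' t - U t)) := by fun_prop
  set B : ℝ → ℝ := fun t => fderiv ℝ X (U t) (V t) * (U' t - U t).im + X (U t) * (V' t - V t).im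
  have cB : Continuous B := by
    have : Continuous (fun t => fderiv ℝ X (U t) (V t)) := (hdX.comp hUc).clm_apply hV
    fun_prop
  -- `B` is the derivative of the periodic function `X(U) Im(U' - U)`.
  have hB : ∫ t in (0 : ℝ)..(2 * Real.pi), B t = 0 := by
    have hd : ∀ t, HasDerivAt (fun t => X (U t) * (U' t - U t).im) (B t) t := fun t =>
      (((hX.differentiable one_ne_zero (U t)).hasFDerivAt).comp_hasDerivAt t (hU t)).mul
        (Complex.imCLM.hasFDerivAt.comp_hasDerivAt t ((hU' t).sub (hU t)))
    rw [intervalIntegral.integral_eq_sub_of_hasDerivAt (fun t _ => hd t)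
      (cB.intervalIntegrable _ _)]
    have h1 := hper 0
    have h2 := hper' 0
    rw [zero_add] at h1 h2
    rw [h1, h2, sub_self]
  have hint : action H U' V' - action H U V - ∫ t in (0 : ℝ)..(2 * Real.pi),
      inner ℝ (-Complex.I * (H (U t) • V t) - unitVec t) (U' t - U t) =
      ∫ t in (0 : ℝ)..(2 * Real.pi), ((X (U' t) - X (U t) - fderiv ℝ X (U t) (U' t - U t)) *
        (V t).im + (X (U' t) - X (U t)) * (V' t - V t).im) := by
    rw [action, action, ← intervalIntegral.integral_sub (cF'.intervalIntegrable _ _)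
      (cF.intervalIntegrable _ _), ← intervalIntegral.integral_sub
      ((cF'.fun_sub cF).intervalIntegrable _ _) (cG.intervalIntegrable _ _)]
    have hsub : ∀ x : ℝ, x = x - ∫ t in (0 : ℝ)..(2 * Real.pi), B t := fun x => by
      rw [hB, sub_zero]
    refine (hsub _).trans ?_
    rw [← intervalIntegral.integral_sub
      (((cF'.fun_sub cF).fun_sub cG).intervalIntegrable _ _) (cB.intervalIntegrable _ _)]
    congr 1
    ext t
    -- In `dX(W) Im V - dX(V) Im W` the terms with `∂X/∂y` cancel, leaving `H (Re W Im V - Re V Im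
    -- W) = ⟨-i H V, W⟩`.
    have hlin : ∀ w : ℂ, fderiv ℝ X (U t) w =
        H (U t) * w.re + fderiv ℝ X (U t) Complex.I * w.im := by
      intro w
      have hw : w = w.re • (1 : ℂ) + w.im • Complex.I := by simp
      conv_lhs => rw [hw]
      rw [map_add, map_smul, map_smul, fderiv_rePrimitive_one hH, smul_eq_mul, smul_eq_mul]
      ring
    simp only [B]
    rw [hlin (U' t - U t), hlin (V t)]
    simp only [Complex.inner, Complex.mul_re, Complex.conj_re, Complex.conj_im, Complex.sub_re,
      Complex.sub_im, Complex.neg_re, Complex.neg_im, Complex.I_re, Complex.I_im,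
      Complex.smul_re, Complex.smul_im, Complex.mul_im, smul_eq_mul, X]
    ring
  rw [hint]
  have hbound := intervalIntegral.norm_integral_le_of_norm_le_const (a := 0) (b := 2 * Real.pi)
    (f := fun t => (X (U' t) - X (U t) - fderiv ℝ X (U t) (U' t - U t)) *
        (V t).im + (X (U' t) - X (U t)) * (V' t - V t).im) (C := η * c * ρ + L * c * c)
    (fun t _ => by
      refine (norm_add_le _ _).trans (add_le_add ?_ ?_)
      · rw [norm_mul]
        exact mul_le_mul (htaylor t) ((Complex.abs_im_le_norm _).trans (hVρ t)) (norm_nonneg _)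
          ((abs_nonneg _).trans (htaylor t))
      · rw [norm_mul]
        exact mul_le_mul (hlip t) ((Complex.abs_im_le_norm _).trans (hVV t)) (norm_nonneg _)
          ((abs_nonneg _).trans (hlip t)))
  rwa [sub_zero, abs_of_pos Real.two_pi_pos] at hbound

variable {K : ℂ → ℝ} {R M k ε : ℝ}

lemma integral_curveOf {v : ℝ → ℂ} (z : ℂ) (hv : Continuous v) :
    ∫ t in (0 : ℝ)..(2 * Real.pi), curveOf z v t = (2 * Real.pi) • z := by
  unfold curveOf
  rw [intervalIntegral.integral_add intervalIntegrable_const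
    ((continuous_meanFreePrimitive hv).intervalIntegrable _ _), integral_meanFreePrimitive hv,
    intervalIntegral.integral_const, sub_zero, add_zero]

/-- The reduced action is differentiable, and its gradient at `z` is the constant by which the
curve of mean `z` fails to be a critical point of the action. -/
lemma hasFDerivAt_action (hK : ContDiff ℝ 1 K) (hM : BoundedLipschitz K (R + 26) M)
    (hk : 1 ≤ k) (hε : |ε| * (120 * M) ≤ 1) {vel : ℂ → ℝ → ℂ}
    (hvel : ∀ z, ‖z‖ ≤ R → IsVelocity (2 * k⁻¹) (vel z))
    (hfix : ∀ z, ‖z‖ ≤ R → velocityMap K k ε z (vel z) = vel z) {z : ℂ} (hz : ‖z‖ < R) :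
    HasFDerivAt (fun z => action (fun w => k + ε * K w) (curveOf z (vel z)) (vel z))
      (innerSL ℝ ((2 * Real.pi) • (-Complex.I * ε • mean (weighted K z (vel z))))) z := by
  set H : ℂ → ℝ := fun w => k + ε * K w
  have hH : ContDiff ℝ 1 H := contDiff_const.add (contDiff_const.mul hK)
  have hX := contDiff_rePrimitive hH
  have hk0 : 0 < k := one_pos.trans_le hk
  have hk1 : k⁻¹ ≤ 1 := inv_le_one_of_one_le₀ hk
  have hρ : 2 * k⁻¹ ≤ 2 := by linarith
  have hπ := Real.pi_lt_d2
  have hπ0 := Real.pi_pos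
  rw [hasFDerivAt_iff_isLittleO, Asymptotics.isLittleO_iff]
  intro c hc
  -- The constants 400 and 2500 are chosen for the final estimate: with increments at most `14 ‖x -
  -- z‖` (as `1 + 4π < 14`), the error is at most `2π (28/400 + 196/2500) c ‖x - z‖ ≤ c ‖x - z‖`.
  obtain ⟨L, hL, -, hlip⟩ := exists_bound_and_lipschitz hX (R + 26)
  obtain ⟨d, hd, htaylor⟩ := exists_uniform_taylor hX (R + 26) (η := c / 400) (by positivity)
  have hball : ∀ᶠ x in 𝓝 z, ‖x - z‖ < min (d / 14) (c / (2500 * L)) := by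
    have : ContinuousAt (fun x => ‖x - z‖) z := by fun_prop
    exact this.eventually_lt_const (by simp only [sub_self, norm_zero]; positivity)
  have hR : ∀ᶠ x in 𝓝 z, ‖x‖ < R := continuous_norm.continuousAt.eventually_lt_const hz
  filter_upwards [hball, hR] with x hx hxR
  have hvz := hvel z hz.le
  have hvx := hvel x hxR.le
  have hVV : ∀ t, ‖vel x t - vel z t‖ ≤ ‖x - z‖ :=
    norm_fixed_velocity_sub_le hK.continuous hM hxR.le hz.le hk hε hvx hvz
      (hfix x hxR.le) (hfix z hz.le)
  have hUU : ∀ t, ‖curveOf x (vel x) t - curveOf z (vel z) t‖ ≤ 14 * ‖x - z‖ := fun t => by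
    have := norm_curveOf_sub_le x z hvx hvz hVV t
    nlinarith [norm_nonneg (x - z)]
  have h14 : 14 * ‖x - z‖ ≤ d := by
    have := hx.le.trans (min_le_left _ _)
    linarith
  have hsmall : 2500 * L * ‖x - z‖ ≤ c := by
    have := hx.le.trans (min_le_right _ _)
    rw [le_div_iff₀ (by positivity)] at this
    linarith
  have key := first_variation hH (hasDerivAt_curveOf z hvz.continuous)
    (hasDerivAt_curveOf x hvx.continuous) hvz.continuous hvx.continuous
    (curveOf_periodic z hvz) (curveOf_periodic x hvx) (η := c / 400) (L := L)
    (c := 14 * ‖x - z‖) (ρ := 2)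
    (fun t => (htaylor _ (curveOf_mem hz.le hρ hvz t) _ (curveOf_mem hxR.le hρ hvx t)
      ((hUU t).trans h14)).trans (mul_le_mul_of_nonneg_left (hUU t) (by positivity)))
    (fun t => (hlip _ (curveOf_mem hz.le hρ hvz t) _ (curveOf_mem hxR.le hρ hvx t)).trans
      (mul_le_mul_of_nonneg_left (hUU t) hL.le))
    (fun t => (hvz.norm_le t).trans hρ)
    (fun t => (hVV t).trans (by linarith [norm_nonneg (x - z)]))
  -- The first variation is constant in `t`, so it pairs only with the integral of the difference of
  -- the curves, which is `2π (x - z)`.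
  have hlin : ∫ t in (0 : ℝ)..(2 * Real.pi),
      inner ℝ (-Complex.I * (H (curveOf z (vel z) t) • vel z t) - unitVec t)
        (curveOf x (vel x) t - curveOf z (vel z) t) =
      innerSL ℝ ((2 * Real.pi) • (-Complex.I * ε • mean (weighted K z (vel z)))) (x - z) := by
    have h1 : ∀ t, -Complex.I * (H (curveOf z (vel z) t) • vel z t) - unitVec t =
        -Complex.I * ε • mean (weighted K z (vel z)) := fun t => by
      rw [fixed_velocity_equation hk0 (hfix z hz.le) t, mul_add, ← mul_assoc, neg_mul,
        Complex.I_mul_I, neg_neg, one_mul]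
      ring
    have cz := continuous_curveOf z hvz.continuous
    have cx := continuous_curveOf x hvx.continuous
    simp only [h1]
    have h2 := (innerSL ℝ (-Complex.I * ε • mean (weighted K z (vel z)))).intervalIntegral_comp_comm
      (μ := MeasureTheory.volume) ((cx.fun_sub cz).intervalIntegrable 0 (2 * Real.pi))
    simp only [innerSL_apply_apply] at h2
    rw [h2, intervalIntegral.integral_sub (cx.intervalIntegrable _ _) (cz.intervalIntegrable _ _),
      integral_curveOf x hvx.continuous, integral_curveOf z hvz.continuous, ← smul_sub,
      innerSL_apply_apply, inner_smul_left, inner_smul_right]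
    rfl
  rw [hlin] at key
  rw [Real.norm_eq_abs]
  refine key.trans ?_
  have hδ := norm_nonneg (x - z)
  have e1 : (c / 400 * (14 * ‖x - z‖) * 2 + L * (14 * ‖x - z‖) * (14 * ‖x - z‖)) ≤
      c * ‖x - z‖ * 0.15 := by
    nlinarith [mul_le_mul_of_nonneg_right hsmall hδ, mul_nonneg hc.le hδ]
  have e2 : 0 ≤ c * ‖x - z‖ := mul_nonneg hc.le hδ
  nlinarith [mul_le_mul_of_nonneg_right e1 Real.two_pi_pos.le]

end Action

/-! ### The rescaled gradient for large curvature -/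

section Asymptotics

lemma integral_apply_unitVec_mul_inner (L : ℂ →L[ℝ] ℝ) (w : ℂ) :
    ∫ t in (0 : ℝ)..(2 * Real.pi), L (unitVec t) * inner ℝ (unitVec t) w = Real.pi * L w := by
  have hlin : ∀ w : ℂ, L w = w.re * L 1 + w.im * L Complex.I := by
    intro w
    have hw : w = w.re • (1 : ℂ) + w.im • Complex.I := by simp
    conv_lhs => rw [hw]
    rw [map_add, map_smul, map_smul, smul_eq_mul, smul_eq_mul]
  have h : ∀ t, L (unitVec t) * inner ℝ (unitVec t) w =
      (L 1 * w.re) * Real.cos t ^ 2 + (L Complex.I * w.im) * Real.sin t ^ 2 +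
        (L 1 * w.im + L Complex.I * w.re) * (Real.sin t * Real.cos t) := by
    intro t
    rw [hlin, Complex.inner, Complex.mul_re, Complex.conj_re, Complex.conj_im, unitVec_re,
      unitVec_im]
    ring
  simp only [h]
  rw [intervalIntegral.integral_add (Continuous.intervalIntegrable (by fun_prop) _ _)
    (Continuous.intervalIntegrable (by fun_prop) _ _),
    intervalIntegral.integral_add (Continuous.intervalIntegrable (by fun_prop) _ _)
    (Continuous.intervalIntegrable (by fun_prop) _ _),
    intervalIntegral.integral_const_mul, intervalIntegral.integral_const_mul,
    intervalIntegral.integral_const_mul, integral_cos_sq, integral_sin_sq,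
    integral_sin_mul_cos₁, hlin w]
  simp
  ring

/-- The gradient of the reduced action, rescaled. -/
noncomputable def reducedGradient (K : ℂ → ℝ) (k : ℝ) (z : ℂ) (v : ℝ → ℂ) : ℂ :=
  (k ^ 2 / Real.pi) • (-Complex.I * ∫ t in (0 : ℝ)..(2 * Real.pi), weighted K z v t)

/-- On the circle of radius `q = 1/k`, the linear part of `K` integrates against the normal to `π
q²` times the differential, whence the factor `k²/π`. The other contributions are `o(q²)`, uniformly
in `z`. -/
lemma exists_reducedGradient_close {K : ℂ → ℝ} (hK : ContDiff ℝ 1 K) {R : ℝ} {δ : ℝ}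
    (hδ : 0 < δ) :
    ∃ k₁ : ℝ, 1 ≤ k₁ ∧ ∀ k, k₁ ≤ k → ∀ z : ℂ, ‖z‖ ≤ R → ∀ v : ℝ → ℂ, IsVelocity (2 * k⁻¹) v →
      (∀ t, ‖v t - k⁻¹ • (Complex.I * unitVec t)‖ ≤ k⁻¹ ^ 2) →
      ‖innerSL ℝ (reducedGradient K k z v) - fderiv ℝ K z‖ ≤ δ := by
  obtain ⟨M, hM, hMb, -⟩ := exists_bound_and_lipschitz hK (R + 26)
  -- After rescaling, the Taylor error contributes `104 · δ/208 = δ/2`; the deviation from the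
  -- circle contributes `2(13 · 2 + 1) M q = 54 M q ≤ δ/2`.
  obtain ⟨d, hd, htaylor⟩ := exists_uniform_taylor hK (R + 26) (η := δ / 208) (by positivity)
  refine ⟨max 1 (max (108 * M / δ) (26 / d)), le_max_left _ _, fun k hk z hz v hv hclose => ?_⟩
  have hπ := Real.pi_lt_d2
  have hπ0 := Real.pi_pos
  have hk1 : 1 ≤ k := (le_max_left _ _).trans hk
  have hk0 : 0 < k := one_pos.trans_le hk1
  set q := k⁻¹
  have hq : 0 < q := inv_pos.2 hk0
  have hq1 : q ≤ 1 := inv_le_one_of_one_le₀ hk1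
  have hkq : k * q = 1 := mul_inv_cancel₀ hk0.ne'
  have hMq : 108 * M * q ≤ δ := by
    have h := ((le_max_left _ _).trans (le_max_right _ _)).trans hk
    rw [div_le_iff₀ hδ] at h
    calc 108 * M * q ≤ k * δ * q := mul_le_mul_of_nonneg_right h hq.le
      _ = (k * q) * δ := by ring
      _ = δ := by rw [hkq, one_mul]
  have hdq : 26 * q ≤ d := by
    have h := ((le_max_right _ _).trans (le_max_right _ _)).trans hk
    rw [div_le_iff₀ hd] at h
    calc 26 * q ≤ k * d * q := mul_le_mul_of_nonneg_right h hq.le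
      _ = (k * q) * d := by ring
      _ = d := by rw [hkq, one_mul]
  have hzmem : z ∈ Metric.closedBall (0 : ℂ) (R + 26) := by
    rw [mem_closedBall_zero_iff]; linarith
  set L := fderiv ℝ K z
  have hLM : ‖L‖ ≤ M := (hMb z hzmem).2
  set φ := meanFreePrimitive v
  have hφ : ∀ t, ‖φ t‖ ≤ 26 * q := fun t => by
    have := norm_meanFreePrimitive_le hv t
    nlinarith
  have hφe : ∀ t, ‖φ t - q • unitVec t‖ ≤ 13 * q ^ 2 := fun t => by
    have := norm_meanFreePrimitive_sub_le hv (isVelocity_circle hq.le) hclose t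
    rw [meanFreePrimitive_circle] at this
    nlinarith [sq_nonneg q]
  have hT : ∀ t, |K (curveOf z v t) - K z - L (φ t)| ≤ δ / 208 * (26 * q) := fun t => by
    have h := htaylor z hzmem _ (curveOf_mem hz (by linarith) hv t)
    have hs : curveOf z v t - z = φ t := by simp [curveOf, φ]
    rw [hs] at h
    exact (h ((hφ t).trans hdq)).trans (mul_le_mul_of_nonneg_left (hφ t) (by positivity))
  refine ContinuousLinearMap.opNorm_le_bound _ hδ.le fun w => ?_
  set p : ℝ → ℝ := fun t => inner ℝ (-Complex.I * v t) w
  have hp : ∀ t, |p t| ≤ 2 * q * ‖w‖ := fun t => by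
    refine (abs_real_inner_le_norm _ _).trans (mul_le_mul_of_nonneg_right ?_ (norm_nonneg _))
    simpa using hv.norm_le t
  have hpe : ∀ t, |p t - q * inner ℝ (unitVec t) w| ≤ q ^ 2 * ‖w‖ := fun t => by
    have h : p t - q * inner ℝ (unitVec t) w =
        inner ℝ (-Complex.I * (v t - q • (Complex.I * unitVec t))) w := by
      have : -Complex.I * (v t - q • (Complex.I * unitVec t)) =
          -Complex.I * v t - q • unitVec t := by
        rw [mul_sub, mul_smul_comm, ← mul_assoc, neg_mul, neg_mul, Complex.I_mul_I, neg_neg,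
          one_mul]
      rw [this, inner_sub_left, inner_smul_left]
      rfl
    rw [h]
    refine (abs_real_inner_le_norm _ _).trans (mul_le_mul_of_nonneg_right ?_ (norm_nonneg _))
    simpa using hclose t
  have cK : Continuous (fun t => K (curveOf z v t)) :=
    hK.continuous.comp (continuous_curveOf z hv.continuous)
  have cp : Continuous p := by
    have := hv.continuous
    fun_prop
  have he := continuous_unitVec
  have hpint : ∀ u : ℝ → ℂ, Continuous u →
      ∫ t in (0 : ℝ)..(2 * Real.pi), inner ℝ (-Complex.I * u t) w =
        inner ℝ (-Complex.I * ∫ t in (0 : ℝ)..(2 * Real.pi), u t) w := fun u hu => by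
    have hcu : Continuous (fun t => -Complex.I * u t) := continuous_const.mul hu
    have h2 := (innerSL ℝ w).intervalIntegral_comp_comm
      (μ := MeasureTheory.volume) (hcu.intervalIntegrable 0 (2 * Real.pi))
    simp only [innerSL_apply_apply] at h2
    rw [real_inner_comm, ← intervalIntegral.integral_const_mul, ← h2]
    simp only [real_inner_comm]
  have hp0 : ∫ t in (0 : ℝ)..(2 * Real.pi), p t = 0 := by
    rw [hpint v hv.continuous, hv.integral_eq_zero, mul_zero, inner_zero_left]
  have hKp : ∫ t in (0 : ℝ)..(2 * Real.pi), K (curveOf z v t) * p t =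
      inner ℝ (-Complex.I * ∫ t in (0 : ℝ)..(2 * Real.pi), weighted K z v t) w := by
    rw [← hpint _ (continuous_weighted hK.continuous z hv.continuous)]
    congr 1
    ext t
    rw [weighted, mul_smul_comm, inner_smul_left]
    rfl
  have cLq : Continuous (fun t => L (unitVec t) * inner ℝ (unitVec t) w) := by fun_prop
  have hint : (∫ t in (0 : ℝ)..(2 * Real.pi), K (curveOf z v t) * p t) -
      q ^ 2 * (Real.pi * L w) = ∫ t in (0 : ℝ)..(2 * Real.pi),
        ((K (curveOf z v t) - K z - L (φ t)) * p t + (L (φ t - q • unitVec t) * p t +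
          q * L (unitVec t) * (p t - q * inner ℝ (unitVec t) w))) := by
    -- The value `K z` can be subtracted because `p` has integral zero. The integrand then splits
    -- into the Taylor error, the error in the position and the error in the velocity.
    have hsub : ∀ x y : ℝ, x - y = x - K z * (∫ t in (0 : ℝ)..(2 * Real.pi), p t) - y :=
      fun x y => by rw [hp0, mul_zero, sub_zero]
    refine (hsub _ _).trans ?_
    rw [← integral_apply_unitVec_mul_inner, ← intervalIntegral.integral_const_mul,
      ← intervalIntegral.integral_const_mul, ← intervalIntegral.integral_sub
      ((cK.fun_mul cp).intervalIntegrable _ _) ((continuous_const.fun_mul cp).intervalIntegrable _ _),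
      ← intervalIntegral.integral_sub
      (((cK.fun_mul cp).fun_sub (continuous_const.fun_mul cp)).intervalIntegrable _ _)
      ((continuous_const.fun_mul cLq).intervalIntegrable _ _)]
    congr 1
    ext t
    rw [map_sub, map_smul, smul_eq_mul]
    ring
  have hbound := intervalIntegral.norm_integral_le_of_norm_le_const (a := 0) (b := 2 * Real.pi)
    (f := fun t => ((K (curveOf z v t) - K z - L (φ t)) * p t + (L (φ t - q • unitVec t) * p t +
          q * L (unitVec t) * (p t - q * inner ℝ (unitVec t) w))))
    (C := δ / 208 * (26 * q) * (2 * q * ‖w‖) + (M * (13 * q ^ 2) * (2 * q * ‖w‖) +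
      q * M * (q ^ 2 * ‖w‖)))
    (fun t _ => by
      refine (norm_add_le _ _).trans (add_le_add ?_ ((norm_add_le _ _).trans (add_le_add ?_ ?_)))
      · rw [norm_mul]
        exact mul_le_mul (hT t) (hp t) (norm_nonneg _) (by positivity)
      · rw [norm_mul]
        refine mul_le_mul ((L.le_opNorm _).trans ?_) (hp t) (norm_nonneg _) (by positivity)
        exact mul_le_mul hLM (hφe t) (norm_nonneg _) hM.le
      · rw [norm_mul, norm_mul, Real.norm_of_nonneg hq.le]
        refine mul_le_mul (mul_le_mul_of_nonneg_left ?_ hq.le) (hpe t) (norm_nonneg _)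
          (by positivity)
        have := L.le_opNorm (unitVec t)
        rw [norm_unitVec, mul_one] at this
        exact this.trans hLM)
  rw [← hint, sub_zero, abs_of_pos Real.two_pi_pos, hKp] at hbound
  have hexpr : (innerSL ℝ (reducedGradient K k z v) - L) w = (k ^ 2 / Real.pi) *
      (inner ℝ (-Complex.I * ∫ t in (0 : ℝ)..(2 * Real.pi), weighted K z v t) w -
        q ^ 2 * (Real.pi * L w)) := by
    have hk2 : k ^ 2 * q ^ 2 = 1 := by rw [← mul_pow, hkq, one_pow]
    rw [sub_apply, innerSL_apply_apply, reducedGradient, inner_smul_left]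
    have : (k ^ 2 / Real.pi) * (q ^ 2 * (Real.pi * L w)) = L w := by
      calc _ = (k ^ 2 * q ^ 2) * (Real.pi / Real.pi) * L w := by ring
        _ = L w := by rw [hk2, div_self hπ0.ne', one_mul, one_mul]
    rw [mul_sub, this]
    rfl
  rw [hexpr, norm_mul, Real.norm_of_nonneg (by positivity : 0 ≤ k ^ 2 / Real.pi)]
  refine (mul_le_mul_of_nonneg_left hbound (by positivity)).trans ?_
  have hw := norm_nonneg w
  calc _ = (k * q) ^ 2 * (Real.pi / Real.pi) * ((δ / 2 + 54 * M * q) * ‖w‖) := by ring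
    _ = (δ / 2 + 54 * M * q) * ‖w‖ := by rw [hkq, div_self hπ0.ne', one_pow, one_mul, one_mul]
    _ ≤ δ * ‖w‖ := mul_le_mul_of_nonneg_right (by linarith) hw

end Asymptotics

/-! ### Critical points of the reduced action, loops and their limits -/

section Existence

variable {K : ℂ → ℝ} {R M k ε : ℝ} {z : ℂ} {v : ℝ → ℂ}

lemma reducedGradient_eq_mean (K : ℂ → ℝ) (k : ℝ) (z : ℂ) (v : ℝ → ℂ) :
    reducedGradient K k z v = (2 * k ^ 2) • (-Complex.I * mean (weighted K z v)) := by
  rw [reducedGradient, mean, mul_smul_comm, smul_smul]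
  congr 1
  have := Real.pi_ne_zero
  field_simp

lemma continuousOn_mean_weighted (hK : Continuous K) (hM : BoundedLipschitz K (R + 26) M)
    (hk : 1 ≤ k) (hε : |ε| * (120 * M) ≤ 1) {vel : ℂ → ℝ → ℂ}
    (hvel : ∀ z, ‖z‖ ≤ R → IsVelocity (2 * k⁻¹) (vel z))
    (hfix : ∀ z, ‖z‖ ≤ R → velocityMap K k ε z (vel z) = vel z) :
    ContinuousOn (fun z => mean (weighted K z (vel z))) (Metric.closedBall 0 R) := by
  have hρ : 2 * k⁻¹ ≤ 2 := by linarith [inv_le_one_of_one_le₀ hk]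
  refine (LipschitzOnWith.of_dist_le_mul (K := Real.toNNReal (M * 29))
    fun x hx y hy => ?_).continuousOn
  rw [mem_closedBall_zero_iff] at hx hy
  have hM0 := hM.nonneg
  rw [dist_eq_norm, dist_eq_norm, Real.coe_toNNReal _ (by positivity),
    mean_sub (continuous_weighted hK x (hvel x hx).continuous)
      (continuous_weighted hK y (hvel y hy).continuous)]
  refine norm_mean_le fun t => ?_
  refine (norm_weighted_sub_le hM hx hy hρ (hvel x hx) (hvel y hy)
    (norm_fixed_velocity_sub_le hK hM hx hy hk hε (hvel x hx) (hvel y hy) (hfix x hx)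
      (hfix y hy)) t).trans (le_of_eq (by ring))

/-- The stability hypothesis is applied to the rescaled reduced action. Its differential at a
critical point is a nonzero multiple of the defect, so the defect vanishes there. -/
lemma exists_mean_weighted_eq_zero (hK : ContDiff ℝ 1 K) (hM : BoundedLipschitz K (R + 26) M)
    {A : Set ℂ} (hAR : closure A ⊆ Metric.ball 0 R) {r δ : ℝ} (hδr : δ < r) (hδR : δ * R < r)
    (hstab : ∀ (G : ℂ → ℝ) (D : ℂ → ℂ →L[ℝ] ℝ), IsC1Closure A G D →
      (∀ z ∈ closure A, |G z - K z| < r ∧ ‖D z - fderiv ℝ K z‖ < r) → ∃ z ∈ A, D z = 0)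
    (hk : 1 ≤ k) (hε : |ε| * (120 * M) ≤ 1) (hε0 : ε ≠ 0)
    (hclose : ∀ z : ℂ, ‖z‖ ≤ R → ∀ v : ℝ → ℂ, IsVelocity (2 * k⁻¹) v →
      (∀ t, ‖v t - k⁻¹ • (Complex.I * unitVec t)‖ ≤ k⁻¹ ^ 2) →
      ‖innerSL ℝ (reducedGradient K k z v) - fderiv ℝ K z‖ ≤ δ) :
    ∃ z ∈ A, ∃ v, IsVelocity (2 * k⁻¹) v ∧ velocityMap K k ε z v = v ∧
      mean (weighted K z v) = 0 := by
  have hk0 : 0 < k := one_pos.trans_le hk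
  have hex : ∀ z : ℂ, ∃ v, ‖z‖ ≤ R → IsVelocity (2 * k⁻¹) v ∧ velocityMap K k ε z v = v := by
    intro z
    by_cases hz : ‖z‖ ≤ R
    · obtain ⟨v, hv⟩ := exists_fixed_velocity hK.continuous hM hz hk hε
      exact ⟨v, fun _ => hv⟩
    · exact ⟨0, fun h => (hz h).elim⟩
  choose vel hvel' using hex
  have hvel : ∀ z, ‖z‖ ≤ R → IsVelocity (2 * k⁻¹) (vel z) := fun z hz => (hvel' z hz).1
  have hfix : ∀ z, ‖z‖ ≤ R → velocityMap K k ε z (vel z) = vel z := fun z hz => (hvel' z hz).2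
  have hball : ∀ z ∈ Metric.ball (0 : ℂ) R, ‖z‖ < R := fun z hz => mem_ball_zero_iff.1 hz
  set f : ℂ → ℝ := fun z => action (fun w => k + ε * K w) (curveOf z (vel z)) (vel z)
  set c : ℝ := k ^ 2 / (Real.pi * ε)
  -- The additive constant gives `G 0 = K 0`. Closeness of the differentials on the convex ball then
  -- controls `G - K` itself, whatever the shape of `A`.
  set G : ℂ → ℝ := fun z => c * f z + (K 0 - c * f 0)
  set D : ℂ → ℂ →L[ℝ] ℝ := fun z => innerSL ℝ (reducedGradient K k z (vel z))
  have hG : ∀ z ∈ Metric.ball (0 : ℂ) R, HasFDerivAt G (D z) z := by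
    intro z hz
    have h := ((hasFDerivAt_action hK hM hk hε hvel hfix (hball z hz)).const_mul c).add_const
      (K 0 - c * f 0)
    have hD : D z = c • innerSL ℝ
        ((2 * Real.pi) • (-Complex.I * ε • mean (weighted K z (vel z)))) := by
      simp only [D]
      rw [reducedGradient_eq_mean, ← map_smul, smul_smul, mul_smul_comm ε, smul_smul]
      congr 2
      have := Real.pi_ne_zero
      simp only [c]
      field_simp
    rw [hD]
    exact h
  have hDK : ∀ z ∈ Metric.ball (0 : ℂ) R, ‖D z - fderiv ℝ K z‖ ≤ δ := fun z hz =>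
    hclose z (hball z hz).le _ (hvel z (hball z hz).le)
      (norm_fixed_velocity_sub_circle_le hM (hball z hz).le hk hε (hvel z (hball z hz).le)
        (hfix z (hball z hz).le))
  have hGK : ∀ z ∈ Metric.ball (0 : ℂ) R, |G z - K z| ≤ δ * R := by
    intro z hz
    have hR : 0 < R := (norm_nonneg z).trans_lt (hball z hz)
    have h := (convex_ball (0 : ℂ) R).norm_image_sub_le_of_norm_hasFDerivWithin_le
      (f := fun z => G z - K z) (f' := fun z => D z - fderiv ℝ K z)
      (fun x hx => ((hG x hx).sub
        (hK.differentiable one_ne_zero x).hasFDerivAt).hasFDerivWithinAt) hDK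
      (Metric.mem_ball_self hR) hz
    have h0 : G 0 - K 0 = 0 := by simp only [G]; ring
    have hδ : 0 ≤ δ := (norm_nonneg _).trans (hDK z hz)
    simp only [h0, sub_zero] at h
    exact h.trans (mul_le_mul_of_nonneg_left (hball z hz).le hδ)
  have hDc : ContinuousOn D (closure A) := by
    have h := (continuousOn_mean_weighted hK.continuous hM hk hε hvel hfix).mono
      (hAR.trans Metric.ball_subset_closedBall)
    refine (innerSL ℝ).continuous.comp_continuousOn ?_
    simp only [reducedGradient_eq_mean]
    exact (continuousOn_const.mul h).const_smul (2 * k ^ 2)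
  obtain ⟨z, hzA, hz⟩ := hstab G D
    ⟨fun z hz => (hG z (hAR hz)).continuousAt.continuousWithinAt, hDc,
      fun z hz => hG z (hAR (subset_closure hz))⟩
    fun z hz => ⟨(hGK z (hAR hz)).trans_lt hδR, (hDK z (hAR hz)).trans_lt hδr⟩
  have hzR := (hball z (hAR (subset_closure hzA))).le
  refine ⟨z, hzA, vel z, hvel z hzR, hfix z hzR, ?_⟩
  have h0 : reducedGradient K k z (vel z) = 0 := by
    have := DFunLike.congr_fun hz (reducedGradient K k z (vel z))
    simpa [D] using this
  rw [reducedGradient_eq_mean] at h0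
  have h1 := (smul_eq_zero.1 h0).resolve_left (by positivity)
  exact (mul_eq_zero.1 h1).resolve_left (neg_ne_zero.2 Complex.I_ne_zero)

/-- The velocities `v` of closed curves with mean value `z` that solve the equation of
`(k + ε K)`-loops, where `z` is a critical point of `K` or of the reduced action. -/
structure IsLoopVelocity (K : ℂ → ℝ) (k ε : ℝ) (z : ℂ) (v : ℝ → ℂ) : Prop where
  isVelocity : IsVelocity (2 * k⁻¹) v
  fixed : velocityMap K k ε z v = v
  balanced : ε • mean (weighted K z v) = 0
  critical : fderiv ℝ K z = 0 ∨ reducedGradient K k z v = 0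

/-- For `ε = 0` the defect vanishes at every centre and imposes nothing. Stability applied to `K`
itself supplies a critical centre, which the limit statement needs. -/
lemma exists_isLoopVelocity (hK : ContDiff ℝ 1 K) (hM : BoundedLipschitz K (R + 26) M)
    {A : Set ℂ} (hAR : closure A ⊆ Metric.ball 0 R) {r δ : ℝ} (hr : 0 < r) (hδr : δ < r)
    (hδR : δ * R < r)
    (hstab : ∀ (G : ℂ → ℝ) (D : ℂ → ℂ →L[ℝ] ℝ), IsC1Closure A G D →
      (∀ z ∈ closure A, |G z - K z| < r ∧ ‖D z - fderiv ℝ K z‖ < r) → ∃ z ∈ A, D z = 0)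
    (hk : 1 ≤ k) (hε : |ε| * (120 * M) ≤ 1)
    (hclose : ∀ z : ℂ, ‖z‖ ≤ R → ∀ v : ℝ → ℂ, IsVelocity (2 * k⁻¹) v →
      (∀ t, ‖v t - k⁻¹ • (Complex.I * unitVec t)‖ ≤ k⁻¹ ^ 2) →
      ‖innerSL ℝ (reducedGradient K k z v) - fderiv ℝ K z‖ ≤ δ) :
    ∃ z ∈ A, ∃ v, IsLoopVelocity K k ε z v := by
  by_cases hε0 : ε = 0
  · obtain ⟨z, hzA, hz⟩ := hstab K (fderiv ℝ K)
      ⟨hK.continuous.continuousOn, (hK.continuous_fderiv one_ne_zero).continuousOn,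
        fun z _ => (hK.differentiable one_ne_zero z).hasFDerivAt⟩
      fun z _ => by simp [hr]
    obtain ⟨v, hv, hfix⟩ := exists_fixed_velocity (z := z) hK.continuous hM
      (mem_ball_zero_iff.1 (hAR (subset_closure hzA))).le hk hε
    exact ⟨z, hzA, v, hv, hfix, by rw [hε0, zero_smul], Or.inl hz⟩
  · obtain ⟨z, hzA, v, hv, hfix, hm⟩ :=
      exists_mean_weighted_eq_zero hK hM hAR hδr hδR hstab hk hε hε0 hclose
    exact ⟨z, hzA, v, hv, hfix, by rw [hm, smul_zero],
      Or.inr (by rw [reducedGradient_eq_mean, hm, mul_zero, smul_zero])⟩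

lemma half_le_curvature (hM : BoundedLipschitz K (R + 26) M) (hz : ‖z‖ ≤ R) (hk : 2 ≤ k)
    (hε : |ε| * (120 * M) ≤ 1) (hv : IsVelocity (2 * k⁻¹) v) (t : ℝ) :
    k / 2 ≤ k + ε * K (curveOf z v t) := by
  have hk1 : k⁻¹ ≤ 1 := inv_le_one_of_one_le₀ (by linarith)
  have h := hM.bound _ (curveOf_mem hz (by linarith) hv t)
  have h1 : |ε * K (curveOf z v t)| ≤ |ε| * M := by
    rw [abs_mul]; exact mul_le_mul_of_nonneg_left h (abs_nonneg _)
  have h2 := neg_abs_le (ε * K (curveOf z v t))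
  nlinarith

lemma IsLoopVelocity.hasDerivAt (hv : IsLoopVelocity K k ε z v) (hk : 0 < k)
    (hpos : ∀ t, 0 < k + ε * K (curveOf z v t)) (t : ℝ) :
    HasDerivAt (curveOf z v)
      ((k + ε * K (curveOf z v t))⁻¹ • (Complex.I * unitVec t)) t := by
  have h := fixed_velocity_equation hk hv.fixed t
  rw [hv.balanced, add_zero] at h
  rw [← h, smul_smul, inv_mul_cancel₀ (hpos t).ne', one_smul]
  exact hasDerivAt_curveOf z hv.isVelocity.continuous t

lemma IsLoopVelocity.isEmbeddedLoop (hK : ContDiff ℝ 1 K) (hM : BoundedLipschitz K (R + 26) M)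
    (hz : ‖z‖ ≤ R) (hk : 2 ≤ k) (hε : |ε| * (120 * M) ≤ 1) (hv : IsLoopVelocity K k ε z v) :
    IsEmbeddedLoop (fun w => k + ε * K w) (circleCurve (curveOf z v)) := by
  have hpos : ∀ t, 0 < k + ε * K (curveOf z v t) := fun t =>
    (half_pos (by linarith)).trans_le (half_le_curvature hM hz hk hε hv.isVelocity t)
  exact isEmbeddedLoop_of_ode (contDiff_const.add (contDiff_const.mul hK)) hpos
    (hv.hasDerivAt (by linarith) hpos) (curveOf_periodic z hv.isVelocity)

/-- The three orders give `8π/k`, `2/k` and `3/k`. In the second derivative, `2/k` bounds the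
reciprocal of the curvature and `1/k` bounds the term with the gradient of `K`. -/
lemma IsLoopVelocity.norm_iteratedDeriv_sub_le (hK : ContDiff ℝ 1 K)
    (hM : BoundedLipschitz K (R + 26) M)
    (hM' : ∀ a ∈ Metric.closedBall (0 : ℂ) (R + 26), ‖fderiv ℝ K a‖ ≤ M)
    (hz : ‖z‖ ≤ R) (hk : 2 ≤ k) (hε : |ε| * (120 * M) ≤ 1) (hv : IsLoopVelocity K k ε z v)
    (z₀ : ℂ) {m : ℕ} (hm : m ≤ 2) (t : ℝ) :
    ‖iteratedDeriv m (curveOf z v) t - iteratedDeriv m (fun _ => z₀) t‖ ≤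
      ‖z - z₀‖ + 26 * k⁻¹ := by
  have hk0 : 0 < k := by linarith
  have hq : 0 < k⁻¹ := inv_pos.2 hk0
  have hk1 : k⁻¹ ≤ 1 := inv_le_one_of_one_le₀ (by linarith)
  have hvel := hv.isVelocity
  have hz0 := norm_nonneg (z - z₀)
  have hd : deriv (curveOf z v) = v := funext fun t =>
    (hasDerivAt_curveOf z hvel.continuous t).deriv
  interval_cases m
  · rw [iteratedDeriv_zero, iteratedDeriv_zero, curveOf, add_sub_right_comm]
    have h := norm_meanFreePrimitive_le hvel t
    have hπ := Real.pi_lt_d2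
    exact (norm_add_le _ _).trans (add_le_add le_rfl (h.trans (by nlinarith)))
  · rw [iteratedDeriv_one, iteratedDeriv_one, hd, deriv_const, sub_zero]
    linarith [hvel.norm_le t]
  · have h2 : ∀ w : ℝ → ℂ, iteratedDeriv 2 w = deriv (deriv w) := fun w => by
      rw [iteratedDeriv_succ, iteratedDeriv_one]
    have hhalf := half_le_curvature hM hz hk hε hvel
    have hpos : ∀ t, 0 < k + ε * K (curveOf z v t) := fun t => (half_pos hk0).trans_le (hhalf t)
    have h := hasDerivAt_deriv_of_ode (contDiff_const.add (contDiff_const.mul hK)) hpos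
      (hv.hasDerivAt hk0 hpos) t
    have hfd : fderiv ℝ (fun w => k + ε * K w) (curveOf z v t) =
        ε • fderiv ℝ K (curveOf z v t) :=
      (((hK.differentiable one_ne_zero _).hasFDerivAt.const_mul ε).const_add k).fderiv
    rw [h2, h2, deriv_const', deriv_const, sub_zero, h.deriv, hfd, hd]
    set H := k + ε * K (curveOf z v t)
    have hH : 0 < H := hpos t
    have hHi : H⁻¹ ≤ 2 * k⁻¹ := by
      have := inv_anti₀ (half_pos hk0) (hhalf t)
      rwa [inv_div, div_eq_mul_inv] at this
    have hHi1 : H⁻¹ ≤ 1 := inv_le_one_of_one_le₀ (by linarith [hhalf t])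
    have hK' : |(ε • fderiv ℝ K (curveOf z v t)) (v t)| ≤ k⁻¹ := by
      rw [smul_apply, smul_eq_mul, abs_mul]
      have h3 := (fderiv ℝ K (curveOf z v t)).le_opNorm (v t)
      have h4 := mul_le_mul (hM' _ (curveOf_mem hz (by linarith) hvel t)) (hvel.norm_le t)
        (norm_nonneg _) hM.nonneg
      have h5 := mul_le_mul_of_nonneg_left (h3.trans h4) (abs_nonneg ε)
      refine h5.trans ?_
      nlinarith [mul_le_mul_of_nonneg_right hε hq.le]
    refine (norm_add_le _ _).trans ?_
    rw [norm_smul, norm_smul, norm_mul, norm_mul, norm_unitVec, Complex.norm_I, mul_one, mul_one,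
      mul_one, Real.norm_of_nonneg (inv_pos.2 hH).le, norm_div, norm_neg, norm_pow,
      Real.norm_of_nonneg hH.le, Real.norm_eq_abs, div_eq_mul_inv, ← inv_pow]
    have h6 : H⁻¹ ^ 2 ≤ 1 := pow_le_one₀ (inv_pos.2 hH).le hHi1
    have h7 : |(ε • fderiv ℝ K (curveOf z v t)) (v t)| * H⁻¹ ^ 2 ≤ k⁻¹ * 1 :=
      mul_le_mul hK' h6 (by positivity) hq.le
    linarith

end Existence

theorem theoremT (K : ℂ → ℝ) (hK : ContDiff ℝ 1 K)
    (A : Set ℂ) (hA : IsOpen A) (hAc : IsCompact (closure A))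
    (hstab : HasStableCriticalPoint K A) :
    ∃ k₀ : ℝ, 1 < k₀ ∧ ∃ (ε₀ : ℝ → ℝ) (u : ℝ → ℝ → Circle → ℂ),
      (∀ k : ℝ, k₀ < k → 0 < ε₀ k ∧
        ∀ ε : ℝ, |ε| < ε₀ k → IsEmbeddedLoop (fun z => k + ε * K z) (u k ε)) ∧
      ∀ k ε : ℕ → ℝ, (∀ h, k₀ < k h ∧ |ε h| < ε₀ (k h)) →
        Tendsto k atTop atTop → Tendsto ε atTop (𝓝 0) →
        ∃ φ : ℕ → ℕ, StrictMono φ ∧ ∃ z₀ ∈ closure A, fderiv ℝ K z₀ = 0 ∧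
          TendstoC2 (fun j => u (k (φ j)) (ε (φ j))) (fun _ => z₀) := by
  obtain ⟨r, hr, hstab⟩ := hstab
  obtain ⟨R, hR, hAR⟩ := hAc.isBounded.subset_ball_lt 0 0
  obtain ⟨M, hM0, hMb, hMlip⟩ := exists_bound_and_lipschitz hK (R + 26)
  have hM : BoundedLipschitz K (R + 26) M := ⟨hM0.le, fun a ha => (hMb a ha).1, hMlip⟩
  have hnorm : ∀ z ∈ A, ‖z‖ ≤ R := fun z hz =>
    (mem_ball_zero_iff.1 (hAR (subset_closure hz))).le
  obtain ⟨δ, hδ, hδr, hδR⟩ : ∃ δ > 0, δ < r ∧ δ * R < r := by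
    refine ⟨r / (2 * (1 + R)), by positivity, ?_, ?_⟩
    · rw [div_lt_iff₀ (by positivity)]; nlinarith
    · rw [div_mul_eq_mul_div, div_lt_iff₀ (by positivity)]; nlinarith
  obtain ⟨k₁, hk₁, hclose⟩ := exists_reducedGradient_close hK (R := R) hδ
  have hε' : ∀ ε : ℝ, |ε| < 1 / (120 * M) → |ε| * (120 * M) ≤ 1 := fun ε h =>
    ((lt_div_iff₀ (by positivity)).1 h).le
  have hex : ∀ k ε : ℝ, ∃ z v, max 2 k₁ < k → |ε| < 1 / (120 * M) →
      z ∈ A ∧ IsLoopVelocity K k ε z v := by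
    intro k ε
    by_cases h : max 2 k₁ < k ∧ |ε| < 1 / (120 * M)
    · have hk := (le_max_right _ _).trans h.1.le
      obtain ⟨z, hz, v, hv⟩ := exists_isLoopVelocity hK hM hAR hr hδr hδR hstab
        (hk₁.trans hk) (hε' ε h.2) (hclose k hk)
      exact ⟨z, v, fun _ _ => ⟨hz, hv⟩⟩
    · exact ⟨0, 0, fun h1 h2 => (h ⟨h1, h2⟩).elim⟩
  choose Z V hZV using hex
  -- The bound on `ε` does not depend on `k`. The lower bound 2 on `k` also keeps the curvature at
  -- least 1 along the loops.
  refine ⟨max 2 k₁, one_lt_two.trans_le (le_max_left _ _), fun _ => 1 / (120 * M),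
    fun k ε => circleCurve (curveOf (Z k ε) (V k ε)), fun k hk => ⟨by positivity, fun ε hε => ?_⟩,
    fun k ε hkε hk _ => ?_⟩
  · obtain ⟨hz, hv⟩ := hZV k ε hk hε
    exact hv.isEmbeddedLoop hK hM (hnorm _ hz) ((le_max_left _ _).trans hk.le) (hε' ε hε)
  · have hA' : ∀ h, Z (k h) (ε h) ∈ A := fun h => (hZV _ _ (hkε h).1 (hkε h).2).1
    have hV : ∀ h, IsLoopVelocity K (k h) (ε h) (Z (k h) (ε h)) (V (k h) (ε h)) :=
      fun h => (hZV _ _ (hkε h).1 (hkε h).2).2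
    have h2 : ∀ h, 2 ≤ k h := fun h => (le_max_left _ _).trans (hkε h).1.le
    have hε'' : ∀ h, |ε h| * (120 * M) ≤ 1 := fun h => hε' _ (hkε h).2
    obtain ⟨z₀, hz₀, φ, hφ, hlim⟩ := hAc.tendsto_subseq fun h => subset_closure (hA' h)
    have hkφ : Tendsto (fun j => k (φ j)) atTop atTop := hk.comp hφ.tendsto_atTop
    refine ⟨φ, hφ, z₀, hz₀, ?_, ?_⟩
    -- At each centre either the differential of `K` or the reduced gradient vanishes. In the second
    -- case the gradient comparison, now with arbitrary precision `η`, bounds the differential by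
    -- `η` for large `k`; continuity passes the bound to the limit.
    · refine norm_le_zero_iff.1 (le_of_forall_pos_le_add fun η hη => ?_)
      rw [zero_add]
      obtain ⟨k₂, -, hclose₂⟩ := exists_reducedGradient_close hK (R := R) hη
      refine le_of_tendsto
        (((hK.continuous_fderiv one_ne_zero).norm.tendsto z₀).comp hlim) ?_
      filter_upwards [hkφ.eventually_ge_atTop k₂] with j hj
      rcases (hV (φ j)).critical with h | h
      · simp only [Function.comp_apply, h, norm_zero]
        exact hη.le
      · have := hclose₂ _ hj _ (hnorm _ (hA' (φ j))) _ (hV (φ j)).isVelocity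
          (norm_fixed_velocity_sub_circle_le hM (hnorm _ (hA' (φ j)))
            (one_le_two.trans (h2 _)) (hε'' _) (hV (φ j)).isVelocity (hV (φ j)).fixed)
        rwa [h, map_zero, zero_sub, norm_neg] at this
    · intro m hm
      have hb : Tendsto (fun j => ‖Z (k (φ j)) (ε (φ j)) - z₀‖ + 26 * (k (φ j))⁻¹) atTop
          (𝓝 0) := by
        have h := ((hlim.sub_const z₀).norm).add
          ((tendsto_inv_atTop_zero.comp hkφ).const_mul 26)
        simpa using h
      rw [Metric.tendstoUniformly_iff]
      intro η hη
      filter_upwards [hb.eventually_lt_const hη] with j hj t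
      rw [angleLift_circleCurve (curveOf_periodic _ (hV (φ j)).isVelocity), dist_comm,
        dist_eq_norm]
      exact ((hV (φ j)).norm_iteratedDeriv_sub_le hK hM (fun a ha => (hMb a ha).2)
        (hnorm _ (hA' (φ j))) (h2 _) (hε'' _) z₀ hm t).trans_lt hj
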